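/- All groups are finite. Let $\pi$ be a set of primes and $\pi'$ its complement in the set of all primes. A group is a $\pi$-group if every prime dividing its order lies in $\pi$, and a Hall $\pi$-subgroup of $G$ is a $\pi$-subgroup whose index in $G$ is divisible by no prime of $\pi$. A group $G$ is $\pi$-soluble if it has a series $1=G_0\lhd G_1\lhd\cdots\lhd G_m=G$ in which every factor $G_i/G_{i-1}$ is a $p$-group for some $p\in\pi$ or a $\pi'$-group. It is $p$-nilpotent if it has a normal Hall $p'$-subgroup (where $p'$ is the set of all primes other than $p$), and $\pi$-nilpotent if it is $p$-nilpotent for every $p\in\pi$; $\mathfrak N^\pi$ denotes the class of all $\pi$-nilpotent groups. For a non-empty Fitting class $\mathfrak F$ (a class closed under normal subgroups and under products of normal $\mathfrak F$-subgroups), $G_{\mathfrak F}$ denotes the largest normal subgroup of $G$ belonging to $\mathfrak F$, and for Fitting classes $\mathfrak F,\mathfrak H$ one puts $\mathfrak F\mathfrak H=\{G : G/G_{\mathfrak F}\in\mathfrak H\}$. Let $(\mathfrak N^\pi)^0$ be the class of groups of order one and $(\mathfrak N^\pi)^{k+1}=(\mathfrak N^\pi)^k\,\mathfrak N^\pi$.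 For a class $\mathfrak F$, a subgroup $V$ of $K$ is $\mathfrak F$-maximal in $K$ if $V\in\mathfrak F$ and $V=U$ whenever $V\le U\le K$ and $U\in\mathfrak F$; a subgroup $V$ of $G$ is an $\mathfrak F$-injector of $G$ if $V\cap K$ is an $\mathfrak F$-maximal subgroup of $K$ for every subnormal subgroup $K$ of $G$. Then for every natural number $k\ge 0$, every $\pi$-soluble group $G$ has an $(\mathfrak N^\pi)^k$-injector, and any two $(\mathfrak N^\pi)^k$-injectors of $G$ are conjugate in $G$. -/

import Mathlib

/-! All groups in the theorem are finite; subgroups and quotients of finite groups are finite,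
so the classes below are only ever evaluated at finite groups. -/

universe u

namespace PiSol

/-- A class of groups. All the classes constructed below are closed under isomorphism. -/
abbrev GroupClass : Type (u + 1) := ∀ (G : Type u) [Group G], Prop

/-- `G` is a `π`-group: every prime dividing `|G|` lies in `π`.
A `π'`-group is a `πᶜ`-group, since only primes are tested. -/
def IsPiGroup (π : Set ℕ) (G : Type u) [Group G] : Prop :=
  ∀ p : ℕ, p.Prime → p ∣ Nat.card G → p ∈ π

/-- `H` is a Hall `π`-subgroup: `H` is a `π`-group and no prime of `π` divides `|G : H|`. -/
def IsHall (π : Set ℕ) {G : Type u} [Group G] (H : Subgroup G) : Prop :=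
  IsPiGroup π H ∧ ∀ p : ℕ, p.Prime → p ∣ H.index → p ∉ π

/-- `G` is `p`-nilpotent: it has a normal Hall `p'`-subgroup. -/
def IsPNilpotent (p : ℕ) (G : Type u) [Group G] : Prop :=
  ∃ N : Subgroup G, N.Normal ∧ IsHall ({p}ᶜ : Set ℕ) N

/-- The class `𝔑^π` of `π`-nilpotent groups: `p`-nilpotent for every `p ∈ π`. -/
def PiNilpotent (π : Set ℕ) : GroupClass.{u} :=
  fun G _ => ∀ p ∈ π, IsPNilpotent p G

/-- `G` is `π`-soluble: there is a series `1 = H 0 ⊴ H 1 ⊴ ⋯ ⊴ H m = G` each of whose factors is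
a `p`-group for some `p ∈ π` or a `π'`-group. -/
def IsPiSoluble (π : Set ℕ) (G : Type u) [Group G] : Prop :=
  ∃ (m : ℕ) (H : ℕ → Subgroup G), H 0 = ⊥ ∧ H m = ⊤ ∧
    ∀ i < m, H i ≤ H (i + 1) ∧
      ∃ _ : ((H i).subgroupOf (H (i + 1))).Normal,
        (∃ p ∈ π, IsPGroup p (H (i + 1) ⧸ (H i).subgroupOf (H (i + 1)))) ∨
          IsPiGroup πᶜ (H (i + 1) ⧸ (H i).subgroupOf (H (i + 1)))

/-- The `𝔉`-radical `G_𝔉`: the subgroup generated by all normal `𝔉`-subgroups of `G`. For a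
non-empty Fitting class and finite `G` it is the largest normal `𝔉`-subgroup. -/
def radical (F : GroupClass.{u}) (G : Type u) [Group G] : Subgroup G :=
  sSup {N : Subgroup G | N.Normal ∧ F N}

instance radical_normal (F : GroupClass.{u}) (G : Type u) [Group G] : (radical F G).Normal := by
  unfold radical
  rw [sSup_eq_iSup']
  have : ∀ N : {N : Subgroup G | N.Normal ∧ F N}, (N : Subgroup G).Normal := fun N => N.2.1
  exact Subgroup.iSup_normal _

/-- The Fitting product `𝔉ℌ = (G ∣ G / G_𝔉 ∈ ℌ)`. -/
def fittingProd (F H : GroupClass.{u}) : GroupClass.{u} :=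
  fun G _ => H (G ⧸ radical F G)

/-- The class `(1)` of groups of order one, the unit of the Fitting product. -/
def trivialClass : GroupClass.{u} := fun G _ => Subsingleton G

/-- The powers `𝔉^0 = (1)`, `𝔉^(k+1) = 𝔉^k 𝔉` with respect to the Fitting product. -/
def fittingPow (F : GroupClass.{u}) : ℕ → GroupClass.{u}
  | 0 => trivialClass
  | k + 1 => fittingProd (fittingPow F k) F

/-- `V` is an `𝔉`-maximal subgroup of the subgroup `K` of `G`. -/
def IsMaximalIn (F : GroupClass.{u}) {G : Type u} [Group G] (V K : Subgroup G) : Prop :=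
  V ≤ K ∧ F V ∧ ∀ U : Subgroup G, V ≤ U → U ≤ K → F U → U = V

/-- `V` is an `𝔉`-injector of `G`: `V ∩ K` is `𝔉`-maximal in `K` for every subnormal `K`. -/
def IsInjector (F : GroupClass.{u}) {G : Type u} [Group G] (V : Subgroup G) : Prop :=
  ∀ K : Subgroup G, K.IsSubnormal → IsMaximalIn F (V ⊓ K) K

end PiSol

namespace PiSol

/-! Write E for the π'-groups and N for the nilpotent π-groups. A group is π-nilpotent exactly when
it lies in EN (`piNilpotent_iff`), so by associativity of the Fitting product each class in
question, k = 0 apart, has the form F'N with F' = FE. The injectors turn out to be the F'N-maximal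
subgroups containing the F'N-radical (`isInjector_iff_isRadMaximal`); existence is then immediate.

In G/G_{F'} the π'-radical is trivial, and π-solubility makes the N-radical T contain its
centralizer (`HasPiSeries.centralizer_radical_le`). This self-centralizing property forces every V
above the F'N-radical to satisfy V_{F'} = G_{F'} (`radical_eq_of_radical_le`), so everything reduces
to maximal nilpotent π-subgroups V ≥ T of G/G_{F'}.

There, let D_p be the centralizer of the p'-elements of T. For p ≠ q, D_p ∩ D_q centralizes T, hence
lies in T; by coprime action p-elements of D_p commute with q-elements of V. Thus the p-elements of
V, for p in π, form a full Sylow p-subgroup of D_p. Sylow's theorem in each D_p, one prime at a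
time, gives conjugacy (`IsRadMaximal.conj_nilPi`), and it also gives maximality of V ∩ K in a normal
subgroup K (`IsRadMaximal.le_of_inf_le`). -/

/-- `x` is a `p`-element: its order is a power of `p`. -/
def IsPElement (p : ℕ) {G : Type u} [Group G] (x : G) : Prop := ∃ k, x ^ p ^ k = 1

/-! ### Elements of prime power order -/

section Elements

variable {G H : Type u} [Group G] [Group H]

theorem IsPElement.map {p : ℕ} {x : G} (h : IsPElement p x) (f : G →* H) :
    IsPElement p (f x) := by
  obtain ⟨k, hk⟩ := h
  exact ⟨k, by rw [← map_pow, hk, map_one]⟩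

theorem IsPElement.of_injective {p : ℕ} {x : G} (f : G →* H) (hf : Function.Injective f)
    (h : IsPElement p (f x)) : IsPElement p x := by
  obtain ⟨k, hk⟩ := h
  exact ⟨k, hf (by rw [map_pow, hk, map_one])⟩

theorem IsPElement.coe {p : ℕ} {K : Subgroup G} {x : K} (h : IsPElement p x) :
    IsPElement p (x : G) := h.map K.subtype

theorem IsPElement.of_coe {p : ℕ} {K : Subgroup G} {x : K} (h : IsPElement p (x : G)) :
    IsPElement p x := h.of_injective K.subtype K.subtype_injective

theorem IsPElement.conj {p : ℕ} {x : G} (h : IsPElement p x) (g : G) :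
    IsPElement p (g * x * g⁻¹) := h.map (MulAut.conj g).toMonoidHom

theorem IsPElement.inv {p : ℕ} {x : G} (h : IsPElement p x) : IsPElement p x⁻¹ := by
  obtain ⟨k, hk⟩ := h
  exact ⟨k, by rw [inv_pow, hk, inv_one]⟩

theorem eq_one_of_pow_coprime {x : G} {m n : ℕ} (hm : x ^ m = 1) (hn : x ^ n = 1)
    (h : m.Coprime n) : x = 1 := by
  rw [← orderOf_eq_one_iff]
  exact Nat.eq_one_of_dvd_coprimes h (orderOf_dvd_of_pow_eq_one hm) (orderOf_dvd_of_pow_eq_one hn)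

theorem IsPElement.eq_one {p q : ℕ} (hp : p.Prime) (hq : q.Prime) (hpq : p ≠ q) {x : G}
    (h : IsPElement p x) (h' : IsPElement q x) : x = 1 := by
  obtain ⟨k, hk⟩ := h
  obtain ⟨l, hl⟩ := h'
  exact eq_one_of_pow_coprime hk hl (Nat.coprime_pow_primes _ _ hp hq hpq)

theorem IsPElement.eq_one_of_isPiGroup {p : ℕ} (hp : p.Prime) {σ : Set ℕ} (hσ : p ∉ σ)
    (hG : IsPiGroup σ G) {x : G} (h : IsPElement p x) : x = 1 := by
  obtain ⟨k, hk⟩ := h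
  obtain ⟨l, -, hl⟩ := (Nat.dvd_prime_pow hp).1 (orderOf_dvd_of_pow_eq_one hk)
  rw [← orderOf_eq_one_iff, hl]
  rcases Nat.eq_zero_or_pos l with rfl | h0
  · simp
  · exact absurd (hG p hp ((dvd_pow_self p h0.ne').trans (hl ▸ orderOf_dvd_natCard x))) hσ

/-- A `p`-element acting on a `q`-element modulo elements it centralizes centralizes it. -/
theorem IsPElement.commute_of_commutator {p q : ℕ} (hp : p.Prime) (hq : q.Prime) (hpq : p ≠ q)
    {x b : G} (hx : IsPElement p x) (hc : IsPElement q (x * b * x⁻¹ * b⁻¹))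
    (hcomm : Commute x (x * b * x⁻¹ * b⁻¹)) : Commute x b := by
  set c := x * b * x⁻¹ * b⁻¹ with hcdef
  -- Since `x` commutes with `c`, iterating the conjugation multiplies `b` by powers of `c`. Hence
  -- `c` is killed by the same `p`-power as `x`, while it is also a `q`-element.
  have hn : ∀ n : ℕ, x ^ n * b * (x ^ n)⁻¹ = c ^ n * b := by
    intro n
    induction n with
    | zero => simp
    | succ n ih =>
      have h1 : x * b * x⁻¹ = c * b := by simp [hcdef]
      have h2 : x * c ^ n * x⁻¹ = c ^ n := by
        rw [(hcomm.pow_right n).eq]; simp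
      calc x ^ (n + 1) * b * (x ^ (n + 1))⁻¹ = x * (x ^ n * b * (x ^ n)⁻¹) * x⁻¹ := by
            rw [pow_succ']; group
        _ = (x * c ^ n * x⁻¹) * (x * b * x⁻¹) := by rw [ih]; group
        _ = c ^ (n + 1) * b := by rw [h1, h2, pow_succ]; group
  have hcp : IsPElement p c := by
    obtain ⟨k, hk⟩ := hx
    refine ⟨k, ?_⟩
    have := hn (p ^ k)
    rw [hk] at this
    simpa using this.symm
  have hc1 : c = 1 := hcp.eq_one hp hq hpq hc
  have : x * b * x⁻¹ * b⁻¹ = 1 := hcdef ▸ hc1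
  rw [mul_inv_eq_one, mul_inv_eq_iff_eq_mul] at this
  exact this

variable [Finite G]

/-- `B` contains a Sylow subgroup for every prime, so no prime divides its index. This lets
inclusions be checked prime by prime. -/
theorem eq_top_of_isPElement {B : Subgroup G}
    (h : ∀ p : ℕ, p.Prime → ∀ x : G, IsPElement p x → x ∈ B) : B = ⊤ := by
  rw [← Subgroup.index_eq_one]
  by_contra hne
  obtain ⟨p, hp, hdvd⟩ := Nat.exists_prime_and_dvd hne
  have := Fact.mk hp
  let P : Sylow p G := default
  have hle : (P : Subgroup G) ≤ B := fun x hx => by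
    obtain ⟨k, hk⟩ := P.2 ⟨x, hx⟩
    exact h p hp x ⟨k, by simpa using congrArg Subtype.val hk⟩
  exact P.not_dvd_index (hdvd.trans (Subgroup.index_dvd_of_le hle))

theorem le_of_isPElement {V B : Subgroup G}
    (h : ∀ p : ℕ, p.Prime → ∀ x ∈ V, IsPElement p x → x ∈ B) : V ≤ B := by
  rw [← Subgroup.subgroupOf_eq_top]
  refine eq_top_of_isPElement fun p hp x hx => ?_
  exact h p hp x x.2 hx.coe

theorem isPiGroup_iff_pow {σ : Set ℕ} : IsPiGroup σ G ↔
    ∀ x : G, ∃ n : ℕ, n ≠ 0 ∧ (∀ p : ℕ, p.Prime → p ∣ n → p ∈ σ) ∧ x ^ n = 1 := by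
  constructor
  · exact fun h x => ⟨Nat.card G, Nat.card_pos.ne', h, pow_card_eq_one'⟩
  · intro h p hp hdvd
    have := Fact.mk hp
    obtain ⟨x, hx⟩ := exists_prime_orderOf_dvd_card' p hdvd
    obtain ⟨n, -, hn, hxn⟩ := h x
    exact hn p hp (hx ▸ orderOf_dvd_of_pow_eq_one hxn)

theorem isPiGroup_iff_isPElement {σ : Set ℕ} : IsPiGroup σ G ↔
    ∀ p : ℕ, p.Prime → p ∉ σ → ∀ x : G, IsPElement p x → x = 1 := by
  constructor
  · exact fun h p hp hσ x hx => hx.eq_one_of_isPiGroup hp hσ h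
  · intro h p hp hdvd
    by_contra hσ
    have := Fact.mk hp
    obtain ⟨x, hx⟩ := exists_prime_orderOf_dvd_card' p hdvd
    have := h p hp hσ x ⟨1, by rw [pow_one, ← hx, pow_orderOf_eq_one]⟩
    rw [this, orderOf_one] at hx
    exact hp.ne_one hx.symm

end Elements

/-- The class of `σ`-groups. -/
abbrev piGroups (σ : Set ℕ) : GroupClass.{u} := fun G _ => IsPiGroup σ G

/-- The class of nilpotent `π`-groups: `π`-groups in which elements of coprime prime power orders
commute. -/
def nilPi (π : Set ℕ) : GroupClass.{u} := fun G _ => IsPiGroup π G ∧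
  ∀ p q : ℕ, p.Prime → q.Prime → p ≠ q → ∀ x y : G, IsPElement p x → IsPElement q y → Commute x y

/-- Fitting classes of finite groups. -/
structure IsFitting (F : GroupClass.{u}) : Prop where
  of_subsingleton : ∀ (G : Type u) [Group G] [Subsingleton G], F G
  iso : ∀ {G H : Type u} [Group G] [Group H] [Finite G] (_ : G ≃* H), F G → F H
  normal : ∀ {G : Type u} [Group G] [Finite G] (N : Subgroup G), N.Normal → F G → F N
  sup : ∀ {G : Type u} [Group G] [Finite G] (N M : Subgroup G), N.Normal → M.Normal → F N → F M →
    N ⊔ M = ⊤ → F G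

/-! ### Radicals of Fitting classes -/

section Fitting

variable {F : GroupClass.{u}} {G H : Type u} [Group G] [Group H]

theorem le_radical {N : Subgroup G} (hN : N.Normal) (h : F N) : N ≤ radical F G :=
  le_sSup ⟨hN, h⟩

variable [Finite G]

theorem IsFitting.congr {F' : GroupClass.{u}} (hF : IsFitting F)
    (h : ∀ (G : Type u) [Group G] [Finite G], F' G ↔ F G) : IsFitting F' where
  of_subsingleton G _ _ := (h G).2 (hF.of_subsingleton G)
  iso {G H} _ _ _ e hG :=
    have : Finite H := Finite.of_equiv G e.toEquiv
    (h H).2 (hF.iso e ((h G).1 hG))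
  normal N hN hG := (h N).2 (hF.normal N hN ((h _).1 hG))
  sup N M hN hM h1 h2 h3 := (h _).2 (hF.sup N M hN hM ((h N).1 h1) ((h M).1 h2) h3)

theorem IsFitting.of_normal_le (hF : IsFitting F) {K L : Subgroup G} (hKL : K ≤ L)
    (hK : (K.subgroupOf L).Normal) (hL : F L) : F K :=
  hF.iso (Subgroup.subgroupOfEquivOfLe hKL) (hF.normal _ hK hL)

theorem IsFitting.sup_of_normal (hF : IsFitting F) {N M : Subgroup G}
    (hN : (N.subgroupOf (N ⊔ M)).Normal) (hM : (M.subgroupOf (N ⊔ M)).Normal)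
    (h1 : F N) (h2 : F M) : F (N ⊔ M : Subgroup G) := by
  refine hF.sup (N.subgroupOf (N ⊔ M)) (M.subgroupOf (N ⊔ M)) hN hM
    (hF.iso (Subgroup.subgroupOfEquivOfLe le_sup_left).symm h1)
    (hF.iso (Subgroup.subgroupOfEquivOfLe le_sup_right).symm h2) ?_
  rw [← Subgroup.subgroupOf_sup le_sup_left le_sup_right, Subgroup.subgroupOf_self]

/-- A maximal normal `F`-subgroup absorbs every other one, because the join of two is again a normal
`F`-subgroup. -/
theorem IsFitting.radical_mem (hF : IsFitting F) (G : Type u) [Group G] [Finite G] :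
    F (radical F G) := by
  have hne : {N : Subgroup G | N.Normal ∧ F N}.Nonempty :=
    ⟨⊥, Subgroup.normal_bot, hF.of_subsingleton _⟩
  obtain ⟨M, hM⟩ := (Set.toFinite {N : Subgroup G | N.Normal ∧ F N}).exists_maximal hne
  have hMn := hM.1.1
  have : radical F G = M := by
    refine le_antisymm (sSup_le fun N hN => ?_) (le_radical hM.1.1 hM.1.2)
    have hNn := hN.1
    have h := hM.2 (y := M ⊔ N) ⟨Subgroup.sup_normal M N, hF.sup_of_normal
      inferInstance inferInstance hM.1.2 hN.2⟩ le_sup_left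
    exact le_sup_right.trans h
  rw [this]
  exact hM.1.2

theorem IsFitting.radical_eq_top_iff (hF : IsFitting F) : radical F G = ⊤ ↔ F G := by
  constructor
  · intro h
    have := hF.radical_mem G
    rw [h] at this
    exact hF.iso Subgroup.topEquiv this
  · exact fun h => top_le_iff.1 (le_radical Subgroup.normal_top (hF.iso Subgroup.topEquiv.symm h))

theorem IsFitting.map_radical_le (hF : IsFitting F) (e : G ≃* H) :
    (radical F G).map e.toMonoidHom ≤ radical F H :=
  le_radical ((radical_normal F G).map _ e.surjective)
    (hF.iso (e.subgroupMap (radical F G)) (hF.radical_mem G))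

theorem IsFitting.map_radical (hF : IsFitting F) (e : G ≃* H) :
    (radical F G).map e.toMonoidHom = radical F H := by
  have : Finite H := Finite.of_equiv G e.toEquiv
  refine le_antisymm (hF.map_radical_le e) fun x hx => ?_
  exact ⟨e.symm x, hF.map_radical_le e.symm ⟨x, hx, rfl⟩, by simp⟩

theorem IsFitting.normal_map_radical (hF : IsFitting F) (K : Subgroup G) [K.Normal] :
    ((radical F K).map K.subtype).Normal := by
  refine ⟨fun n hn g => ?_⟩
  obtain ⟨x, hx, rfl⟩ := hn
  have := hF.map_radical_le (MulAut.conjNormal (H := K) g) ⟨x, hx, rfl⟩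
  exact ⟨_, this, by simp⟩

/-- The radical of `K` is invariant under automorphisms of `K`, hence normal in `G`. Conversely, the
radical of `G` meets `K` in a normal subgroup of an `F`-group. -/
theorem IsFitting.radical_of_normal (hF : IsFitting F) (K : Subgroup G) (hK : K.Normal) :
    radical F K = (radical F G).subgroupOf K := by
  refine le_antisymm ?_ ?_
  · refine Subgroup.map_le_iff_le_comap.1 ?_
    exact le_radical (hF.normal_map_radical K)
      (hF.iso ((radical F K).equivMapOfInjective _ K.subtype_injective) (hF.radical_mem K))
  · refine le_radical inferInstance ?_
    have h1 : F (radical F G ⊓ K : Subgroup G) :=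
      hF.of_normal_le inf_le_left inferInstance (hF.radical_mem G)
    rw [← Subgroup.inf_subgroupOf_right]
    exact hF.iso (Subgroup.subgroupOfEquivOfLe inf_le_right).symm h1

theorem IsFitting.radical_of_subnormal (hF : IsFitting F) {K : Subgroup G} (hK : K.IsSubnormal) :
    radical F K = (radical F G).subgroupOf K := by
  induction hK with
  | top =>
    have := hF.map_radical (Subgroup.topEquiv (G := G))
    rw [← this]
    ext x
    simp [Subgroup.mem_subgroupOf, Subgroup.mem_map]
  | step A B hAB hB hN ih =>
    have h1 := hF.radical_of_normal (A.subgroupOf B) hN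
    rw [ih] at h1
    rw [← hF.map_radical (Subgroup.subgroupOfEquivOfLe hAB), h1]
    ext x
    simp only [Subgroup.mem_map, Subgroup.mem_subgroupOf]
    constructor
    · rintro ⟨y, hy, rfl⟩
      exact hy
    · intro hx
      exact ⟨⟨⟨x, hAB x.2⟩, x.2⟩, hx, rfl⟩

theorem IsFitting.le_radical_of_subnormal (hF : IsFitting F) {K : Subgroup G}
    (hK : K.IsSubnormal) (h : F K) : K ≤ radical F G := by
  rw [← Subgroup.subgroupOf_eq_top, ← hF.radical_of_subnormal hK]
  exact hF.radical_eq_top_iff.2 h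

end Fitting

/-! ### The Fitting class of σ-groups -/

section PiGroups

variable {G H : Type u} [Group G] [Group H] {σ : Set ℕ}

theorem IsPiGroup.of_injective (h : IsPiGroup σ H) (f : G →* H)
    (hf : Function.Injective f) : IsPiGroup σ G :=
  fun p hp hd => h p hp (hd.trans (Subgroup.card_dvd_of_injective f hf))

theorem IsPiGroup.of_surjective (h : IsPiGroup σ G) (f : G →* H)
    (hf : Function.Surjective f) : IsPiGroup σ H :=
  fun p hp hd => h p hp (hd.trans (Subgroup.card_dvd_of_surjective f hf))

theorem isFitting_piGroups (σ : Set ℕ) : IsFitting (piGroups.{u} σ) where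
  of_subsingleton G _ _ p hp h := by
    rw [Nat.card_of_subsingleton (1 : G)] at h
    exact absurd (Nat.dvd_one.1 h) hp.ne_one
  iso {G H} _ _ _ e hG := hG.of_surjective e.toMonoidHom e.surjective
  normal N _ hG := hG.of_injective N.subtype N.subtype_injective
  sup {G} _ _ N M hN hM h1 h2 h3 := by
    rw [piGroups, isPiGroup_iff_pow]
    intro x
    refine ⟨Nat.card N * Nat.card M, mul_ne_zero Nat.card_pos.ne' Nat.card_pos.ne', ?_, ?_⟩
    · intro p hp hd
      rcases hp.dvd_mul.1 hd with h | h
      exacts [h1 p hp h, h2 p hp h]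
    · have hx : x ∈ N ⊔ M := h3 ▸ Subgroup.mem_top x
      obtain ⟨a, ha, b, hb, rfl⟩ := Subgroup.mem_sup_of_normal_right.1 hx
      have hab : (a * b) ^ Nat.card N ∈ M := by
        rw [← QuotientGroup.eq_one_iff]
        have : ((a * b : G) : G ⧸ M) = (a : G ⧸ M) := by
          rw [QuotientGroup.mk_mul, (QuotientGroup.eq_one_iff b).2 hb, mul_one]
        rw [QuotientGroup.mk_pow, this, ← QuotientGroup.mk_pow]
        have : a ^ Nat.card N = 1 := by
          exact congrArg Subtype.val (pow_card_eq_one' (x := (⟨a, ha⟩ : N)))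
        rw [this, QuotientGroup.mk_one]
      rw [pow_mul]
      exact congrArg Subtype.val (pow_card_eq_one' (x := (⟨_, hab⟩ : M)))

end PiGroups

end PiSol

namespace PiSol

/-! ### Nilpotent π-groups and Fitting's theorem -/

section NilPi

variable {G H : Type u} [Group G] [Group H] {π : Set ℕ}

theorem nilPi.of_injective (h : nilPi π H) (f : G →* H) (hf : Function.Injective f) :
    nilPi π G := by
  refine ⟨h.1.of_injective f hf, fun p q hp hq hpq x y hx hy => hf ?_⟩
  simpa using (h.2 p q hp hq hpq _ _ (hx.map f) (hy.map f)).eq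

theorem nilPi.mono {V U : Subgroup G} (hV : nilPi π V) (hUV : U ≤ V) : nilPi π U :=
  hV.of_injective (Subgroup.inclusion hUV) (Subgroup.inclusion_injective hUV)

theorem nilPi.commute_of_mem {V : Subgroup G} (hV : nilPi π V) {p q : ℕ} (hp : p.Prime)
    (hq : q.Prime) (hpq : p ≠ q) {x y : G} (hx : x ∈ V) (hy : y ∈ V) (hxp : IsPElement p x)
    (hyq : IsPElement q y) : Commute x y :=
  congrArg Subtype.val (hV.2 p q hp hq hpq ⟨x, hx⟩ ⟨y, hy⟩ hxp.of_coe hyq.of_coe).eq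

theorem nilPi.prime_mem {V : Subgroup G} (hV : nilPi π V) {p : ℕ} (hp : p.Prime) {x : G}
    (hx : x ∈ V) (hxp : IsPElement p x) (hx1 : x ≠ 1) : p ∈ π := by
  by_contra hpπ
  have : (⟨x, hx⟩ : V) = 1 :=
    IsPElement.eq_one_of_isPiGroup hp hpπ hV.1 (x := (⟨x, hx⟩ : V)) hxp.of_coe
  exact hx1 (congrArg Subtype.val this)

theorem isPElement_of_mem {p : ℕ} {P : Subgroup G} (hP : IsPGroup p P) {x : G} (hx : x ∈ P) :
    IsPElement p x := by
  obtain ⟨k, hk⟩ := hP ⟨x, hx⟩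
  exact ⟨k, congrArg Subtype.val hk⟩

theorem isPGroup_of_isPElement {p : ℕ} {P : Subgroup G} (h : ∀ x ∈ P, IsPElement p x) :
    IsPGroup p P := by
  rintro ⟨x, hx⟩
  obtain ⟨k, hk⟩ := h x hx
  exact ⟨k, Subtype.ext hk⟩

theorem IsPElement.isPGroup_zpowers {p : ℕ} {x : G} (hx : IsPElement p x) :
    IsPGroup p (Subgroup.zpowers x) := by
  refine isPGroup_of_isPElement ?_
  rintro _ ⟨n, rfl⟩
  obtain ⟨k, hk⟩ := hx
  exact ⟨k, by
    change (x ^ n) ^ p ^ k = 1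
    rw [← zpow_natCast, ← zpow_mul, mul_comm, zpow_mul, zpow_natCast, hk, one_zpow]⟩

variable [Finite G]

theorem isPGroup_iff_isPiGroup {p : ℕ} (hp : p.Prime) : IsPGroup p G ↔ IsPiGroup {p} G := by
  constructor
  · intro h
    rw [isPiGroup_iff_pow]
    intro x
    obtain ⟨k, hk⟩ := h x
    exact ⟨p ^ k, pow_ne_zero _ hp.ne_zero,
      fun q hq hd => (Nat.prime_dvd_prime_iff_eq hq hp).1 (hq.dvd_of_dvd_pow hd), hk⟩
  · intro h
    refine IsPGroup.of_card (n := (Nat.card G).primeFactorsList.length)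
      (Nat.eq_prime_pow_of_unique_prime_dvd Nat.card_pos.ne' fun {q} hq hd => h q hq hd)

/-- In a finite nilpotent group the `p`-elements form a normal subgroup. -/
theorem nilPi.exists_normal_sylow (h : nilPi π G) {p : ℕ} (hp : p.Prime) :
    ∃ P : Subgroup G, P.Normal ∧ IsPGroup p P ∧ ∀ x, IsPElement p x → x ∈ P := by
  have := Fact.mk hp
  let P : Sylow p G := default
  have hN : Subgroup.normalizer ((P : Subgroup G) : Set G) = ⊤ := by
    -- The normalizer contains `P` and, for each prime `q ≠ p`, a Sylow `q`-subgroup, since that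
    -- centralizes `P`. So no prime divides its index.
    rw [← Subgroup.index_eq_one]
    by_contra hne
    obtain ⟨q, hq, hd⟩ := Nat.exists_prime_and_dvd hne
    rcases eq_or_ne q p with rfl | hqp
    · exact P.not_dvd_index (hd.trans (Subgroup.index_dvd_of_le Subgroup.le_normalizer))
    · have := Fact.mk hq
      let Q : Sylow q G := default
      refine Q.not_dvd_index (hd.trans (Subgroup.index_dvd_of_le fun x hx => ?_))
      refine Subgroup.centralizer_le_normalizer _ ?_
      rw [Subgroup.mem_centralizer_iff]
      intro y hy
      exact h.2 p q hp hq hqp.symm y x (isPElement_of_mem P.2 hy) (isPElement_of_mem Q.2 hx)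
  have hPn : (P : Subgroup G).Normal := Subgroup.normalizer_eq_top_iff.1 hN
  refine ⟨P, hPn, P.2, fun x hx => ?_⟩
  obtain ⟨Q, hQ⟩ := hx.isPGroup_zpowers.exists_le_sylow
  obtain ⟨g, rfl⟩ := MulAction.exists_smul_eq G P Q
  rw [Sylow.smul_eq_of_normal] at hQ
  exact hQ (Subgroup.mem_zpowers x)

theorem nilPi.mul_isPElement {V : Subgroup G} (hV : nilPi π V) {p : ℕ} (hp : p.Prime) {x y : G}
    (hx : x ∈ V) (hy : y ∈ V) (hxp : IsPElement p x) (hyp : IsPElement p y) :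
    IsPElement p (x * y) := by
  obtain ⟨P, -, hP, hmem⟩ := hV.exists_normal_sylow hp
  exact (isPElement_of_mem hP (mul_mem (hmem ⟨x, hx⟩ hxp.of_coe) (hmem ⟨y, hy⟩ hyp.of_coe))).coe

/-- The subgroup of `p`-elements of a nilpotent subgroup. -/
theorem nilPi.exists_sylow {V : Subgroup G} (hV : nilPi π V) {p : ℕ} (hp : p.Prime) :
    ∃ P : Subgroup G, IsPGroup p P ∧ ∀ x, x ∈ P ↔ x ∈ V ∧ IsPElement p x := by
  obtain ⟨P, -, hP, hmem⟩ := hV.exists_normal_sylow hp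
  refine ⟨P.map V.subtype, hP.map _, fun x => ⟨?_, fun hx => ⟨⟨x, hx.1⟩, hmem _ hx.2.of_coe, rfl⟩⟩⟩
  rintro ⟨y, hy, rfl⟩
  exact ⟨y.2, (isPElement_of_mem hP hy).coe⟩

theorem nilPi.mem_radical {N : Subgroup G} (hN : N.Normal) (h : nilPi π N) {p : ℕ}
    (hp : p.Prime) {σ : Set ℕ} (hpσ : p ∈ σ) {x : G} (hx : x ∈ N) (hxp : IsPElement p x) :
    x ∈ radical (piGroups σ) G := by
  obtain ⟨P, hPn, hP, hmem⟩ := h.exists_normal_sylow hp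
  have hPσ : IsPiGroup σ P := fun q hq hd => by
    rw [show q = p from (isPGroup_iff_isPiGroup hp).1 hP q hq hd]
    exact hpσ
  have h1 : (⟨x, hx⟩ : N) ∈ radical (piGroups σ) N :=
    le_radical hPn hPσ (hmem ⟨x, hx⟩ hxp.of_coe)
  rwa [(isFitting_piGroups σ).radical_of_normal N hN] at h1

/-- **Fitting's theorem** for nilpotent `π`-groups. -/
theorem isFitting_nilPi (π : Set ℕ) : IsFitting (nilPi.{u} π) where
  of_subsingleton G _ _ :=
    ⟨(isFitting_piGroups π).of_subsingleton G, fun _ _ _ _ _ _ _ _ _ => Subsingleton.elim _ _⟩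
  iso e hG := hG.of_injective e.symm.toMonoidHom e.symm.injective
  normal N _ hG := hG.of_injective N.subtype N.subtype_injective
  sup {G} _ _ N M hN hM h1 h2 h3 := by
    have hdisj : ∀ (p : ℕ) (x : G), p.Prime → x ∈ radical (piGroups {p}) G → IsPElement p x :=
      fun p x hp hx => isPElement_of_mem ((isPGroup_iff_isPiGroup hp).2
        ((isFitting_piGroups {p}).radical_mem G)) hx
    have hcompl : ∀ (p : ℕ) (x : G), p.Prime → x ∈ radical (piGroups {p}ᶜ) G →
        IsPElement p x → x = 1 := fun p x hp hx hxp =>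
      congrArg Subtype.val (IsPElement.eq_one_of_isPiGroup hp (by simp)
        ((isFitting_piGroups {p}ᶜ).radical_mem G) (x := (⟨x, hx⟩ : radical (piGroups {p}ᶜ) G))
        hxp.of_coe)
    have hmem : ∀ (p : ℕ) (x : G), p.Prime → IsPElement p x → x ∈ radical (piGroups {p}) G := by
      intro p x hp hxp
      -- Both factors lie in the direct product of the `p`-radical and the `p'`-radical. A
      -- `p`-element of that product has trivial `p'`-component.
      have hle : ∀ K : Subgroup G, K.Normal → nilPi π K →
          K ≤ radical (piGroups {p}) G ⊔ radical (piGroups {p}ᶜ) G := by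
        intro K hK hKn
        refine le_of_isPElement fun q hq y hy hyq => ?_
        rcases eq_or_ne q p with rfl | hqp
        · exact Subgroup.mem_sup_left (hKn.mem_radical hK hq (Set.mem_singleton q) hy hyq)
        · exact Subgroup.mem_sup_right (hKn.mem_radical hK hq hqp hy hyq)
      have hx : x ∈ N ⊔ M := h3 ▸ Subgroup.mem_top x
      obtain ⟨a, ha, b, hb, rfl⟩ :=
        Subgroup.mem_sup_of_normal_right.1 (sup_le (hle N hN h1) (hle M hM h2) hx)
      have hab : Commute a b := by
        refine Subgroup.commute_of_normal_of_disjoint _ _ (radical_normal _ G) (radical_normal _ G)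
          ?_ a b ha hb
        rw [Subgroup.disjoint_def]
        exact fun h h' => hcompl p _ hp h' (hdisj p _ hp h)
      obtain ⟨k, hk⟩ := hdisj p a hp ha
      obtain ⟨l, hl⟩ := hxp
      have hb1 : b = 1 := by
        refine hcompl p b hp hb ⟨k + l, ?_⟩
        have h := hab.mul_pow (p ^ (k + l))
        have e1 : a ^ p ^ (k + l) = 1 := by rw [pow_add, pow_mul, hk, one_pow]
        have e2 : (a * b) ^ p ^ (k + l) = 1 := by
          rw [pow_add, mul_comm, pow_mul, hl, one_pow]
        rw [e1, e2, one_mul] at h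
        exact h.symm
      rwa [hb1, mul_one]
    refine ⟨(isFitting_piGroups π).sup N M hN hM h1.1 h2.1 h3, ?_⟩
    intro p q hp hq hpq x y hx hy
    refine Subgroup.commute_of_normal_of_disjoint _ _ (radical_normal _ G) (radical_normal _ G)
      ?_ x y (hmem p x hp hx) (hmem q y hq hy)
    rw [Subgroup.disjoint_def]
    exact fun h h' => (hdisj p _ hp h).eq_one hp hq hpq (hdisj q _ hq h')

end NilPi

/-! ### Maximal nilpotent π-subgroups above a self-centralizing radical -/

/-- `V` is an `F`-maximal subgroup of `G` containing the `F`-radical. -/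
structure IsRadMaximal (F : GroupClass.{u}) {G : Type u} [Group G] (V : Subgroup G) : Prop where
  radical_le : radical F G ≤ V
  mem : F V
  le_of_le : ∀ U : Subgroup G, V ≤ U → F U → U ≤ V

section RadMaximal

variable {F : GroupClass.{u}} {G H : Type u} [Group G] [Group H] [Finite G] {π : Set ℕ}

theorem IsFitting.exists_isRadMaximal (hF : IsFitting F) (G : Type u) [Group G] [Finite G] :
    ∃ V : Subgroup G, IsRadMaximal F V := by
  obtain ⟨V, hV⟩ := (Set.toFinite {V : Subgroup G | radical F G ≤ V ∧ F V}).exists_maximal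
    ⟨_, le_rfl, hF.radical_mem G⟩
  exact ⟨V, hV.1.1, hV.1.2, fun U hU h => hV.2 ⟨hV.1.1.trans hU, h⟩ hU⟩

theorem IsRadMaximal.map (hF : IsFitting F) {V : Subgroup G} (hV : IsRadMaximal F V) (e : G ≃* H) :
    IsRadMaximal F (V.map e.toMonoidHom) where
  radical_le := by
    rw [← hF.map_radical e]
    exact Subgroup.map_mono hV.radical_le
  mem := hF.iso (e.subgroupMap V) hV.mem
  le_of_le U hU h := by
    have : Finite H := Finite.of_equiv G e.toEquiv
    have h1 := hV.le_of_le (U.map e.symm.toMonoidHom)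
      (fun x hx => ⟨e x, hU ⟨x, hx, rfl⟩, by simp⟩) (hF.iso (e.symm.subgroupMap U) h)
    exact fun x hx => ⟨e.symm x, h1 ⟨x, hx, rfl⟩, by simp⟩

/-- The centralizer of the Hall `p'`-subgroup of the radical of nilpotent `π`-groups. -/
def coradCentralizer (π : Set ℕ) (p : ℕ) (G : Type u) [Group G] : Subgroup G :=
  Subgroup.centralizer {t | t ∈ radical (nilPi π) G ∧ ∃ q, q.Prime ∧ q ≠ p ∧ IsPElement q t}

omit [Finite G] in
theorem mem_coradCentralizer {p : ℕ} {x : G} : x ∈ coradCentralizer π p G ↔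
    ∀ t ∈ radical (nilPi π) G, ∀ q : ℕ, q.Prime → q ≠ p → IsPElement q t → Commute x t := by
  rw [coradCentralizer, Subgroup.mem_centralizer_iff]
  exact ⟨fun h t ht q hq hqp htq => (h t ⟨ht, q, hq, hqp, htq⟩).symm,
    fun h t ⟨ht, q, hq, hqp, htq⟩ => (h t ht q hq hqp htq).symm⟩

instance coradCentralizer_normal (π : Set ℕ) (p : ℕ) (G : Type u) [Group G] :
    (coradCentralizer π p G).Normal := by
  refine ⟨fun x hx g => ?_⟩
  rw [mem_coradCentralizer] at hx ⊢
  intro t ht q hq hqp htq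
  have h := hx (g⁻¹ * t * g⁻¹⁻¹) ((radical_normal _ G).conj_mem t ht _) q hq hqp (htq.conj _)
  have h2 := h.map (MulAut.conj g).toMonoidHom
  simpa [mul_assoc] using h2

/-- Every prime differs from `p` or from `q`, so between them the two memberships cover all
prime-power elements of the radical. -/
theorem mem_centralizer_of_mem_coradCentralizer {p q : ℕ} (hpq : p ≠ q) {x : G}
    (hxp : x ∈ coradCentralizer π p G) (hxq : x ∈ coradCentralizer π q G) :
    x ∈ Subgroup.centralizer (radical (nilPi π) G : Set G) := by
  rw [mem_coradCentralizer] at hxp hxq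
  have : radical (nilPi π) G ≤ Subgroup.centralizer {x} := by
    refine le_of_isPElement fun r hr t ht htr => ?_
    rw [Subgroup.mem_centralizer_singleton_iff]
    by_cases hrp : r = p
    · exact (hxq t ht r hr (hrp ▸ hpq) htr).symm
    · exact (hxp t ht r hr hrp htr).symm
  rw [Subgroup.mem_centralizer_iff]
  exact fun t ht => Subgroup.mem_centralizer_singleton_iff.1 (this ht)

variable (hC : Subgroup.centralizer (radical (nilPi π) G : Set G) ≤ radical (nilPi π) G)
  {V : Subgroup G} (hTV : radical (nilPi π) G ≤ V) (hV : nilPi π V)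

include hTV hV

omit [Finite G] in
theorem nilPi.mem_coradCentralizer {p : ℕ} (hp : p.Prime) {v : G} (hv : v ∈ V)
    (hvp : IsPElement p v) : v ∈ coradCentralizer π p G :=
  PiSol.mem_coradCentralizer.2 fun _ ht _ hq hqp htq =>
    hV.commute_of_mem hp hq hqp.symm hv (hTV ht) hvp htq

include hC

/-- The commutator lies in both normal subgroups `coradCentralizer π p G` and `coradCentralizer π q
G`, so it centralizes the radical; `hC` puts it inside. -/
theorem nilPi.commutator_mem_radical {p q : ℕ} (hq : q.Prime) (hpq : p ≠ q) {x v : G}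
    (hx : x ∈ coradCentralizer π p G) (hv : v ∈ V) (hvq : IsPElement q v) :
    x * v * x⁻¹ * v⁻¹ ∈ radical (nilPi π) G := by
  have hvD := hV.mem_coradCentralizer hTV hq hv hvq
  refine hC (mem_centralizer_of_mem_coradCentralizer hpq ?_ ?_)
  · rw [mul_assoc, mul_assoc]
    refine mul_mem hx ?_
    rw [← mul_assoc]
    exact (coradCentralizer_normal π p G).conj_mem _ (inv_mem hx) v
  · exact mul_mem ((coradCentralizer_normal π q G).conj_mem _ hvD x) (inv_mem hvD)

theorem nilPi.conj_mem {p q : ℕ} (hq : q.Prime) (hpq : p ≠ q) {x v : G}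
    (hx : x ∈ coradCentralizer π p G) (hv : v ∈ V) (hvq : IsPElement q v) :
    x * v * x⁻¹ ∈ V := by
  have := mul_mem (hTV (hV.commutator_mem_radical hC hTV hq hpq hx hv hvq)) hv
  simpa using this

theorem nilPi.commute_of_mem_coradCentralizer {p q : ℕ} (hp : p.Prime) (hq : q.Prime)
    (hpq : p ≠ q) {x v : G} (hx : x ∈ coradCentralizer π p G) (hxp : IsPElement p x) (hv : v ∈ V)
    (hvq : IsPElement q v) : Commute x v := by
  have hT := hV.commutator_mem_radical hC hTV hq hpq hx hv hvq
  have hcq : IsPElement q (x * v * x⁻¹ * v⁻¹) :=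
    hV.mul_isPElement hq (hV.conj_mem hC hTV hq hpq hx hv hvq) (inv_mem hv) (hvq.conj x) hvq.inv
  exact hxp.commute_of_commutator hp hq hpq hcq
    (PiSol.mem_coradCentralizer.1 hx _ hT q hq hpq.symm hcq)

omit hTV hV

/-- `P` centralizes the subgroup `B` generated by the `p'`-elements of `V` of prime power order. So
`P ⊔ B` is a nilpotent π-group containing `V`, and maximality of `V` applies. -/
theorem IsRadMaximal.isPGroup_le (hV : IsRadMaximal (nilPi π) V) {p : ℕ} (hp : p.Prime)
    (hpπ : p ∈ π) {P : Subgroup G} (hP : IsPGroup p P) (hPD : P ≤ coradCentralizer π p G)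
    (hVP : ∀ v ∈ V, IsPElement p v → v ∈ P) : P ≤ V := by
  let B : Subgroup G := Subgroup.closure {v | v ∈ V ∧ ∃ q, q.Prime ∧ q ≠ p ∧ IsPElement q v}
  have hBV : B ≤ V := (Subgroup.closure_le _).2 fun v hv => hv.1
  have hBP : B ≤ Subgroup.centralizer (P : Set G) := by
    refine (Subgroup.closure_le _).2 ?_
    rintro v ⟨hv, q, hq, hqp, hvq⟩
    rw [SetLike.mem_coe, Subgroup.mem_centralizer_iff]
    exact fun x hx => hV.mem.commute_of_mem_coradCentralizer hC hV.radical_le hp hq hqp.symm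
      (hPD hx) (isPElement_of_mem hP hx) hv hvq
  have hPB : P ≤ Subgroup.centralizer (B : Set G) := Subgroup.le_centralizer_iff.1 hBP
  have hPn : nilPi π P := by
    have hPp := (isPGroup_iff_isPiGroup hp).1 hP
    refine ⟨fun q hq hd => (hPp q hq hd : q = p) ▸ hpπ, fun q r hq hr hqr x y hx hy => ?_⟩
    rcases eq_or_ne q p with rfl | hqp
    · rw [hy.eq_one_of_isPiGroup hr (fun h => hqr h.symm) hPp]
      exact Commute.one_right x
    · rw [hx.eq_one_of_isPiGroup hq hqp hPp]
      exact Commute.one_left y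
  have hsup : nilPi π (P ⊔ B : Subgroup G) := by
    refine (isFitting_nilPi π).sup_of_normal ?_ ?_ hPn (hV.mem.mono hBV)
    · rw [Subgroup.normal_subgroupOf_iff_le_normalizer le_sup_left]
      exact sup_le Subgroup.le_normalizer (hBP.trans (Subgroup.centralizer_le_normalizer _))
    · rw [Subgroup.normal_subgroupOf_iff_le_normalizer le_sup_right]
      exact sup_le (hPB.trans (Subgroup.centralizer_le_normalizer _)) Subgroup.le_normalizer
  have hle : V ≤ P ⊔ B := by
    refine le_of_isPElement fun q hq v hv hvq => ?_
    rcases eq_or_ne q p with rfl | hqp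
    · exact Subgroup.mem_sup_left (hVP v hv hvq)
    · exact Subgroup.mem_sup_right (Subgroup.subset_closure ⟨hv, q, hq, hqp, hvq⟩)
  exact le_sup_left.trans (hV.le_of_le _ hle hsup)

omit hC in
theorem exists_sylow_of_le {p : ℕ} (hp : p.Prime) {D P : Subgroup G} (hP : IsPGroup p P)
    (hPD : P ≤ D) : ∃ S : Subgroup G, P ≤ S ∧ S ≤ D ∧ IsPGroup p S ∧
      ∀ Q : Subgroup G, Q ≤ D → IsPGroup p Q → ∃ d ∈ D, ∀ x ∈ Q, d * x * d⁻¹ ∈ S := by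
  have := Fact.mk hp
  obtain ⟨S, hS⟩ := (hP.comap_subtype (K := D)).exists_le_sylow
  refine ⟨(S : Subgroup D).map D.subtype, fun x hx => ⟨⟨x, hPD hx⟩, hS hx, rfl⟩,
    Subgroup.map_subtype_le _, S.2.map _, fun Q hQD hQ => ?_⟩
  obtain ⟨R, hR⟩ := (hQ.comap_subtype (K := D)).exists_le_sylow
  obtain ⟨d, hd⟩ := MulAction.exists_smul_eq D R S
  refine ⟨d, d.2, fun x hx => ⟨d * ⟨x, hQD hx⟩ * d⁻¹, ?_, by simp⟩⟩
  rw [← hd]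
  exact ⟨⟨x, hQD hx⟩, hR hx, by simp⟩

/-- The `p`-elements of a maximal nilpotent `π`-subgroup over the radical form a Sylow
`p`-subgroup of `coradCentralizer π p G`. -/
theorem IsRadMaximal.exists_conj (hV : IsRadMaximal (nilPi π) V) {p : ℕ} (hp : p.Prime)
    (hpπ : p ∈ π) {Q : Subgroup G} (hQ : IsPGroup p Q) (hQD : Q ≤ coradCentralizer π p G) :
    ∃ d ∈ coradCentralizer π p G, ∀ x ∈ Q, d * x * d⁻¹ ∈ V := by
  obtain ⟨P, hP, hmem⟩ := hV.mem.exists_sylow hp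
  obtain ⟨S, hPS, hSD, hS, hconj⟩ := exists_sylow_of_le hp (D := coradCentralizer π p G) hP
    fun x hx => hV.mem.mem_coradCentralizer hV.radical_le hp ((hmem x).1 hx).1 ((hmem x).1 hx).2
  obtain ⟨d, hd, h⟩ := hconj Q hQD hQ
  exact ⟨d, hd, fun x hx => hV.isPGroup_le hC hp hpπ hS hSD
    (fun v hv hvp => hPS ((hmem v).2 ⟨hv, hvp⟩)) (h x hx)⟩

/-- This yields the injector property for normal `K`. A Sylow `p`-subgroup of `U` lies in
`coradCentralizer π p G`, since its commutators with the radical fall into `V ⊓ K ≤ U`, where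
coprime elements commute. It is therefore conjugate into `V`. -/
theorem IsRadMaximal.le_of_inf_le (hV : IsRadMaximal (nilPi π) V) {K U : Subgroup G}
    (hK : K.Normal) (hUK : U ≤ K) (hU : nilPi π U) (hVU : V ⊓ K ≤ U) : U ≤ V := by
  refine le_of_isPElement fun p hp u hu hup => ?_
  by_cases hu1 : u = 1
  · exact hu1 ▸ one_mem V
  have hpπ := hU.prime_mem hp hu hup hu1
  obtain ⟨P, hP, hPmem⟩ := hU.exists_sylow hp
  have hPD : P ≤ coradCentralizer π p G := by
    intro x hx
    rw [mem_coradCentralizer]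
    intro t ht q hq hqp htq
    have hx' := (hPmem x).1 hx
    have hcT : x * t * x⁻¹ * t⁻¹ ∈ radical (nilPi π) G :=
      mul_mem ((radical_normal _ G).conj_mem t ht x) (inv_mem ht)
    have hcK : x * t * x⁻¹ * t⁻¹ ∈ K := by
      rw [mul_assoc, mul_assoc, ← mul_assoc t]
      exact mul_mem (hUK hx'.1) (hK.conj_mem _ (inv_mem (hUK hx'.1)) t)
    have hcq : IsPElement q (x * t * x⁻¹ * t⁻¹) :=
      ((isFitting_nilPi π).radical_mem G).mul_isPElement hq
        ((radical_normal _ G).conj_mem t ht x) (inv_mem ht) (htq.conj x) htq.inv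
    exact hx'.2.commute_of_commutator hp hq hqp.symm hcq
      (hU.commute_of_mem hp hq hqp.symm hx'.1 (hVU ⟨hV.radical_le hcT, hcK⟩) hx'.2 hcq)
  obtain ⟨d, -, hd⟩ := hV.exists_conj hC hp hpπ hP hPD
  -- The conjugate of `P` by `d` lies in `V ⊓ K ≤ U` and consists of `p`-elements, so it lies in
  -- `P`; by finiteness it equals `P`, whence `P ≤ V`.
  let f : P → P := fun x => ⟨d * x * d⁻¹, (hPmem _).2
    ⟨hVU ⟨hd x x.2, hK.conj_mem _ (hUK ((hPmem _).1 x.2).1) d⟩, ((hPmem _).1 x.2).2.conj d⟩⟩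
  have hf : Function.Injective f := fun x y h => Subtype.ext (by
    simpa [f] using congrArg Subtype.val h)
  obtain ⟨x, hx⟩ := Finite.surjective_of_injective hf ⟨u, (hPmem u).2 ⟨hu, hup⟩⟩
  have hxu : d * (x : G) * d⁻¹ = u := congrArg Subtype.val hx
  exact hxu ▸ hd x x.2

/-- Primes can be treated independently: conjugating by an element of `coradCentralizer π q G` to
place the `q`-elements keeps in `W` the `p`-elements, `p ≠ q`, already moved there. -/
theorem IsRadMaximal.exists_conj_on (s : Finset ℕ) (hs : ∀ p ∈ s, p.Prime) {W : Subgroup G}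
    (hW : IsRadMaximal (nilPi π) W) (hV : IsRadMaximal (nilPi π) V) :
    ∃ g : G, ∀ p ∈ s, ∀ v ∈ V, IsPElement p v → g * v * g⁻¹ ∈ W := by
  induction s using Finset.induction_on with
  | empty => exact ⟨1, by simp⟩
  | insert q s hqs ih =>
    obtain ⟨g, hg⟩ := ih fun p hp => hs p (Finset.mem_insert_of_mem hp)
    have hq := hs q (Finset.mem_insert_self q s)
    by_cases hqπ : q ∈ π
    · have hV' := hV.map (isFitting_nilPi π) (MulAut.conj g)
      have hmemV' : ∀ v ∈ V, g * v * g⁻¹ ∈ V.map (MulAut.conj g).toMonoidHom :=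
        fun v hv => ⟨v, hv, rfl⟩
      obtain ⟨P, hP, hPmem⟩ := hV'.mem.exists_sylow hq
      obtain ⟨d, hd, hdW⟩ := hW.exists_conj hC hq hqπ hP fun x hx =>
        hV'.mem.mem_coradCentralizer hV'.radical_le hq ((hPmem x).1 hx).1 ((hPmem x).1 hx).2
      refine ⟨d * g, fun p hp v hv hvp => ?_⟩
      have e : d * g * v * (d * g)⁻¹ = d * (g * v * g⁻¹) * d⁻¹ := by group
      rw [e]
      rcases Finset.mem_insert.1 hp with rfl | hps
      · exact hdW _ ((hPmem _).2 ⟨hmemV' v hv, hvp.conj g⟩)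
      · exact hW.mem.conj_mem hC hW.radical_le (hs p hp) (by rintro rfl; exact hqs hps) hd
          (hg p hps v hv hvp) (hvp.conj g)
    · refine ⟨g, fun p hp v hv hvp => ?_⟩
      rcases Finset.mem_insert.1 hp with rfl | hps
      · have : v = 1 := by
          by_contra h1
          exact hqπ (hV.mem.prime_mem hq hv hvp h1)
        simp [this]
      · exact hg p hps v hv hvp

theorem IsRadMaximal.conj_nilPi {W : Subgroup G} (hV : IsRadMaximal (nilPi π) V)
    (hW : IsRadMaximal (nilPi π) W) : ∃ g : G, V.map (MulAut.conj g).toMonoidHom = W := by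
  obtain ⟨g, hg⟩ := hW.exists_conj_on hC (Nat.card G).primeFactors
    (fun p hp => Nat.prime_of_mem_primeFactors hp) hV
  have hle : V.map (MulAut.conj g).toMonoidHom ≤ W := by
    rw [Subgroup.map_le_iff_le_comap]
    refine le_of_isPElement fun p hp v hv hvp => ?_
    by_cases hd : p ∣ Nat.card G
    · exact hg p (Nat.mem_primeFactors.2 ⟨hp, hd, Nat.card_pos.ne'⟩) v hv hvp
    · have : v = 1 := hvp.eq_one_of_isPiGroup hp (σ := {p}ᶜ) (by simp)
        fun r _ hr hrp => hd ((hrp : r = p) ▸ hr)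
      exact this ▸ one_mem _
  exact ⟨g, le_antisymm hle
    ((hV.map (isFitting_nilPi π) (MulAut.conj g)).le_of_le W hle hW.mem)⟩

end RadMaximal

end PiSol

/-! ### Series of π-soluble groups and the self-centralizing radical -/

namespace PiSol

/-- A series whose factors are, elementwise, `p`-groups with `p ∈ π` or `π'`-groups. -/
def HasPiSeries (π : Set ℕ) (G : Type u) [Group G] : Prop :=
  ∃ (m : ℕ) (H : ℕ → Subgroup G), H 0 = ⊥ ∧ H m = ⊤ ∧ ∀ i < m, H i ≤ H (i + 1) ∧
    (∀ x ∈ H (i + 1), ∀ h ∈ H i, x * h * x⁻¹ ∈ H i) ∧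
    ∃ σ : Set ℕ, ((∃ p ∈ π, σ = {p}) ∨ σ = πᶜ) ∧ ∀ x ∈ H (i + 1),
      ∃ n : ℕ, n ≠ 0 ∧ (∀ p : ℕ, p.Prime → p ∣ n → p ∈ σ) ∧ x ^ n ∈ H i

variable {π : Set ℕ} {G Q : Type u} [Group G] [Group Q]

theorem IsPiSoluble.hasPiSeries [Finite G] (hπ : ∀ p ∈ π, p.Prime) (h : IsPiSoluble π G) :
    HasPiSeries π G := by
  obtain ⟨m, H, h0, hm, hH⟩ := h
  refine ⟨m, H, h0, hm, fun i hi => ?_⟩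
  obtain ⟨hle, hN, hσ⟩ := hH i hi
  refine ⟨hle, fun x hx y hy => hN.conj_mem ⟨y, hle hy⟩ hy ⟨x, hx⟩, ?_⟩
  have key : ∀ σ : Set ℕ, IsPiGroup σ (H (i + 1) ⧸ (H i).subgroupOf (H (i + 1))) →
      ∀ x ∈ H (i + 1), ∃ n : ℕ, n ≠ 0 ∧ (∀ p : ℕ, p.Prime → p ∣ n → p ∈ σ) ∧ x ^ n ∈ H i := by
    intro σ hσ x hx
    obtain ⟨n, hn, hnσ, h1⟩ := isPiGroup_iff_pow.1 hσ ((⟨x, hx⟩ : H (i + 1)) : _ ⧸ _)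
    refine ⟨n, hn, hnσ, ?_⟩
    rw [← QuotientGroup.mk_pow, QuotientGroup.eq_one_iff] at h1
    exact h1
  rcases hσ with ⟨p, hp, hpg⟩ | hσ
  · exact ⟨{p}, Or.inl ⟨p, hp, rfl⟩, key _ ((isPGroup_iff_isPiGroup (hπ p hp)).1 hpg)⟩
  · exact ⟨πᶜ, Or.inr rfl, key _ hσ⟩

theorem HasPiSeries.of_surjective (h : HasPiSeries π G) (f : G →* Q)
    (hf : Function.Surjective f) : HasPiSeries π Q := by
  obtain ⟨m, H, h0, hm, hH⟩ := h
  refine ⟨m, fun i => (H i).map f, by simp [h0], by simp [hm, Subgroup.map_top_of_surjective f hf],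
    fun i hi => ?_⟩
  obtain ⟨hle, hN, σ, hσ, hpow⟩ := hH i hi
  refine ⟨Subgroup.map_mono hle, ?_, σ, hσ, ?_⟩
  · rintro _ ⟨x, hx, rfl⟩ _ ⟨y, hy, rfl⟩
    exact ⟨_, hN x hx y hy, by simp⟩
  · rintro _ ⟨x, hx, rfl⟩
    obtain ⟨n, hn, hnσ, h1⟩ := hpow x hx
    exact ⟨n, hn, hnσ, _, h1, by simp⟩

theorem HasPiSeries.subgroup (h : HasPiSeries π G) (K : Subgroup G) : HasPiSeries π K := by
  obtain ⟨m, H, h0, hm, hH⟩ := h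
  refine ⟨m, fun i => (H i).subgroupOf K, by simp [h0], by simp [hm], fun i hi => ?_⟩
  obtain ⟨hle, hN, σ, hσ, hpow⟩ := hH i hi
  exact ⟨fun x hx => hle hx, fun x hx y hy => hN x hx y hy, σ, hσ, fun x hx => hpow x hx⟩

theorem IsPElement.mem_of_pow_mem {p : ℕ} (hp : p.Prime) {x : G} (hx : IsPElement p x) {n : ℕ}
    (hn : ¬ p ∣ n) {B : Subgroup G} (h : x ^ n ∈ B) : x ∈ B := by
  obtain ⟨k, hk⟩ := hx
  have hco : n.Coprime (orderOf x) :=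
    Nat.Coprime.coprime_dvd_right (orderOf_dvd_of_pow_eq_one hk)
      (Nat.Coprime.pow_right k ((Nat.Prime.coprime_iff_not_dvd hp).2 hn).symm)
  obtain ⟨l, hl⟩ := exists_pow_eq_self_of_coprime hco
  exact hl ▸ pow_mem h l

theorem isSubnormal_of_series {m : ℕ} {H : ℕ → Subgroup G} (hm : H m = ⊤)
    (hH : ∀ i < m, H i ≤ H (i + 1) ∧ ∀ x ∈ H (i + 1), ∀ h ∈ H i, x * h * x⁻¹ ∈ H i) :
    ∀ i ≤ m, (H i).IsSubnormal := by
  intro i hi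
  induction hi using Nat.decreasingInduction with
  | self => exact hm ▸ Subgroup.IsSubnormal.top
  | of_succ k hk ih =>
    obtain ⟨hle, hN⟩ := hH k hk
    exact Subgroup.IsSubnormal.step _ _ hle ih ⟨fun y hy x => hN x x.2 y hy⟩

/-- A finite group which is an extension of a central `π`-group by a `π'`-group and whose normal
`π'`-subgroups are trivial coincides with that central subgroup. -/
theorem eq_top_of_central_of_radical_eq_bot [Finite G] {Z : Subgroup G} (hZ : Z ≤ Subgroup.center G)
    (hZπ : IsPiGroup π Z)
    (hpow : ∀ x : G, ∃ n : ℕ, n ≠ 0 ∧ (∀ p : ℕ, p.Prime → p ∣ n → p ∈ πᶜ) ∧ x ^ n ∈ Z)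
    (hO : radical (piGroups πᶜ) G = ⊥) : Z = ⊤ := by
  have hZn : Z.Normal := ⟨fun n hn g => by
    rw [Subgroup.mem_center_iff.1 (hZ hn) g, mul_inv_cancel_right]
    exact hn⟩
  have hidx : IsPiGroup πᶜ (G ⧸ Z) := by
    rw [isPiGroup_iff_pow]
    intro x
    obtain ⟨x, rfl⟩ := QuotientGroup.mk_surjective x
    obtain ⟨n, hn, hnσ, h1⟩ := hpow x
    exact ⟨n, hn, hnσ, by rwa [← QuotientGroup.mk_pow, QuotientGroup.eq_one_iff]⟩
  have hco : (Nat.card Z).Coprime Z.index :=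
    Nat.Coprime.symm (Nat.coprime_of_dvd fun p hp h1 h2 => hidx p hp h1 (hZπ p hp h2))
  -- Schur–Zassenhaus gives a complement. It is normal because `Z` is central, and it is a
  -- `π'`-group, hence trivial.
  obtain ⟨N, hN⟩ := Subgroup.exists_right_complement'_of_coprime hco
  have hNn : N.Normal := by
    refine ⟨fun n hn g => ?_⟩
    have hg : g ∈ Z ⊔ N := hN.sup_eq_top ▸ Subgroup.mem_top g
    obtain ⟨z, hz, y, hy, rfl⟩ := Subgroup.mem_sup_of_normal_left.1 hg
    have hc := Subgroup.mem_center_iff.1 (hZ hz) (y * n * y⁻¹)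
    have e : z * y * n * (z * y)⁻¹ = y * n * y⁻¹ := by
      calc z * y * n * (z * y)⁻¹ = z * (y * n * y⁻¹) * z⁻¹ := by group
        _ = y * n * y⁻¹ := by rw [← hc, mul_inv_cancel_right]
    rw [e]
    exact mul_mem (mul_mem hy hn) (inv_mem hy)
  have hNσ : IsPiGroup πᶜ N := fun p hp hd => hidx p hp (by
    rw [← hN.symm.index_eq_card] at hd
    exact hd)
  have hNb : N = ⊥ := le_bot_iff.1 (hO ▸ le_radical hNn hNσ)
  have := hN.sup_eq_top
  rwa [hNb, sup_bot_eq] at this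

/-- Climb the series, showing `C ⊓ H i` lies in the radical and so is central in `C`. Over a
`p`-factor, `C ⊓ H (i + 1)` is a subnormal nilpotent π-group, hence in the radical. Over a
`π'`-factor, it has trivial `π'`-radical, so the central case above shows nothing new appears. -/
theorem HasPiSeries.centralizer_radical_le [Finite G]
    (h : HasPiSeries π G) (hO : radical (piGroups πᶜ) G = ⊥) :
    Subgroup.centralizer (radical (nilPi π) G : Set G) ≤ radical (nilPi π) G := by
  obtain ⟨m, H, h0, hm, hH⟩ := h
  set C := Subgroup.centralizer (radical (nilPi π) G : Set G) with hCdef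
  have hCn : C.Normal := by rw [hCdef]; infer_instance
  have hTπ := ((isFitting_nilPi π).radical_mem G)
  have hsub := isSubnormal_of_series hm fun i hi => ⟨(hH i hi).1, (hH i hi).2.1⟩
  suffices hs : ∀ i ≤ m, C ⊓ H i ≤ radical (nilPi π) G by simpa [hm] using hs m le_rfl
  intro i
  induction i with
  | zero => intro _; simp [h0]
  | succ i ih =>
    intro hi
    have ihi := ih (by omega)
    obtain ⟨-, -, σ, hσ, hpow⟩ := hH i hi
    have hMsub : (C ⊓ H (i + 1)).IsSubnormal :=
      Subgroup.IsSubnormal.step _ (H (i + 1)) inf_le_right (hsub _ hi)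
        (by rw [Subgroup.inf_subgroupOf_right]; infer_instance)
    have hcomm : ∀ z ∈ C ⊓ H i, ∀ x ∈ C, Commute z x := fun z hz x hx =>
      Subgroup.mem_centralizer_iff.1 hx z (ihi hz)
    rcases hσ with ⟨p, hp, rfl⟩ | rfl
    · have hmem : ∀ r : ℕ, r.Prime → r ≠ p → ∀ x : (C ⊓ H (i + 1) : Subgroup G),
          IsPElement r x → (x : G) ∈ C ⊓ H i := by
        intro r hr hrp x hx
        obtain ⟨n, -, hn, h1⟩ := hpow x x.2.2
        exact ⟨x.2.1, hx.coe.mem_of_pow_mem hr (fun hd => hrp (hn r hr hd)) h1⟩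
      refine (isFitting_nilPi π).le_radical_of_subnormal hMsub ⟨?_, ?_⟩
      · refine isPiGroup_iff_isPElement.2 fun r hr hrπ x hx => ?_
        by_contra hx1
        exact hrπ (hTπ.prime_mem hr (ihi (hmem r hr (fun h => hrπ (h ▸ hp)) x hx)) hx.coe
          fun h => hx1 (Subtype.ext h))
      · intro r s hr hs hrs x y hx hy
        refine Subtype.ext ?_
        rcases eq_or_ne r p with rfl | hrp
        · exact (hcomm _ (hmem s hs hrs.symm y hy) x x.2.1).symm.eq
        · exact (hcomm _ (hmem r hr hrp x hx) y y.2.1).eq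
    · have h1 := eq_top_of_central_of_radical_eq_bot (π := π)
        (Z := (C ⊓ H i).subgroupOf (C ⊓ H (i + 1)))
        (fun z hz => Subgroup.mem_center_iff.2 fun x =>
          Subtype.ext (hcomm z hz x x.2.1).symm.eq)
        ((hTπ.1.of_injective (Subgroup.inclusion ihi) (Subgroup.inclusion_injective ihi)).of_injective
          (((C ⊓ H (i + 1)).subtype.comp (Subgroup.subtype _)).codRestrict _ fun z => z.2)
          (fun a b hab => Subtype.ext (Subtype.ext (congrArg (C ⊓ H i).subtype hab))))
        (fun x => by
          obtain ⟨n, hn, hnσ, h1⟩ := hpow x x.2.2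
          exact ⟨n, hn, hnσ, pow_mem x.2.1 n, h1⟩)
        (by
          rw [(isFitting_piGroups πᶜ).radical_of_subnormal hMsub, hO, Subgroup.bot_subgroupOf])
      exact (Subgroup.subgroupOf_eq_top.1 h1).trans ihi

end PiSol

namespace PiSol

/-! ### Products of Fitting classes -/

section FittingProduct

variable {F H L : GroupClass.{u}} {G Q : Type u} [Group G] [Group Q] {π : Set ℕ}

/-- A quotient of a subgroup `K` by its intersection with the kernel is the image of `K`. -/
noncomputable def quotientEquivMap (f : G →* Q) (K : Subgroup G) (N : Subgroup K) [N.Normal]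
    (h : N = f.ker.subgroupOf K) : K ⧸ N ≃* K.map f :=
  (QuotientGroup.quotientMulEquivOfEq (h.trans (Subgroup.ker_subgroupMap K f).symm)).trans
    (QuotientGroup.quotientKerEquivOfSurjective _ (f.subgroupMap_surjective K))

theorem mem_of_map_mem {f : G →* Q} {W : Subgroup G} (hW : f.ker ≤ W) {x : G}
    (hx : f x ∈ W.map f) : x ∈ W := by
  rw [← Subgroup.comap_map_eq_self hW]
  exact hx

theorem map_comap_mk {N : Subgroup G} [N.Normal] (K : Subgroup (G ⧸ N)) :
    (K.comap (QuotientGroup.mk' N)).map (QuotientGroup.mk' N) = K :=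
  Subgroup.map_comap_eq_self_of_surjective (QuotientGroup.mk'_surjective N) K

variable [Finite G]

/-- The map `f` is arbitrary so that subgroups of a normal `K` can later be tested in a quotient of
the whole group. -/
theorem fittingProd_iff_map (hH : IsFitting H) (f : G →* Q) (V : Subgroup G)
    (h : radical F V = f.ker.subgroupOf V) : fittingProd F H V ↔ H (V.map f) := by
  have e := quotientEquivMap f V (radical F V) h
  have : Finite (V.map f) := Finite.of_equiv _ e.toEquiv
  exact ⟨fun hV => hH.iso e hV, fun hV => hH.iso e.symm hV⟩

theorem fittingProd_iff_map_mk (hH : IsFitting H) (V : Subgroup G)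
    (h : radical F V = (radical F G).subgroupOf V) :
    fittingProd F H V ↔ H (V.map (QuotientGroup.mk' (radical F G))) :=
  fittingProd_iff_map hH _ V (by rw [QuotientGroup.ker_mk', h])

theorem IsFitting.fittingProd (hF : IsFitting F) (hH : IsFitting H) :
    IsFitting (fittingProd F H) where
  of_subsingleton G _ _ := hH.of_subsingleton (G ⧸ radical F G)
  iso {G G'} _ _ _ e hG := hH.iso (QuotientGroup.congr _ _ e (hF.map_radical e)) hG
  normal {G} _ _ N hN hG :=
    (fittingProd_iff_map_mk hH N (hF.radical_of_normal N hN)).2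
      (hH.normal _ (hN.map _ (QuotientGroup.mk'_surjective _)) hG)
  sup {G} _ _ N M hN hM h1 h2 h3 := by
    refine hH.sup (G := G ⧸ radical F G) (N.map (QuotientGroup.mk' (radical F G)))
      (M.map (QuotientGroup.mk' (radical F G))) (hN.map _ (QuotientGroup.mk'_surjective _))
      (hM.map _ (QuotientGroup.mk'_surjective _))
      ((fittingProd_iff_map_mk hH N (hF.radical_of_normal N hN)).1 h1)
      ((fittingProd_iff_map_mk hH M (hF.radical_of_normal M hM)).1 h2) ?_
    rw [← Subgroup.map_sup, h3, Subgroup.map_top_of_surjective _ (QuotientGroup.mk'_surjective _)]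

theorem radical_fittingProd (hF : IsFitting F) (hH : IsFitting H) :
    radical (fittingProd F H) G =
      (radical H (G ⧸ radical F G)).comap (QuotientGroup.mk' (radical F G)) := by
  have hFH := hF.fittingProd hH
  refine le_antisymm ?_ ?_
  · rw [← Subgroup.map_le_iff_le_comap]
    refine le_radical ((radical_normal _ G).map _ (QuotientGroup.mk'_surjective _)) ?_
    exact (fittingProd_iff_map_mk hH _ (hF.radical_of_normal _ (radical_normal _ G))).1
      (hFH.radical_mem G)
  · refine le_radical inferInstance ?_
    rw [fittingProd_iff_map_mk hH _ (hF.radical_of_normal _ inferInstance), map_comap_mk]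
    exact hH.radical_mem _

theorem radical_le_radical_fittingProd (hF : IsFitting F) (hH : IsFitting H) :
    radical F G ≤ radical (fittingProd F H) G := by
  rw [radical_fittingProd hF hH]
  conv_lhs => rw [← QuotientGroup.ker_mk' (radical F G)]
  exact Subgroup.ker_le_comap _ _

theorem fittingProd_assoc (hF : IsFitting F) (hH : IsFitting H) (hL : IsFitting L) :
    fittingProd (fittingProd F H) L G ↔ fittingProd F (fittingProd H L) G := by
  let f := (QuotientGroup.mk' (radical H (G ⧸ radical F G))).comp (QuotientGroup.mk' (radical F G))
  have hf : Function.Surjective f :=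
    (QuotientGroup.mk'_surjective _).comp (QuotientGroup.mk'_surjective _)
  have hker : radical (fittingProd F H) G = f.ker := by
    rw [radical_fittingProd hF hH, ← MonoidHom.comap_ker, QuotientGroup.ker_mk']
  have e : G ⧸ radical (fittingProd F H) G ≃*
      (G ⧸ radical F G) ⧸ radical H (G ⧸ radical F G) :=
    (QuotientGroup.quotientMulEquivOfEq hker).trans (QuotientGroup.quotientKerEquivOfSurjective f hf)
  exact ⟨fun h => hL.iso e h, fun h => hL.iso e.symm h⟩

/-- σ-groups are closed under extensions, so the preimage of the σ-radical of the quotient is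
already a normal subgroup in the product class. -/
theorem radical_piGroups_quotient (hF : IsFitting F) (σ : Set ℕ) :
    radical (piGroups σ) (G ⧸ radical (fittingProd F (piGroups σ)) G) = ⊥ := by
  have hE := isFitting_piGroups.{u} σ
  set R := radical (fittingProd F (piGroups σ)) G with hR
  set K := (radical (piGroups σ) (G ⧸ R)).comap (QuotientGroup.mk' R) with hK
  have hKR : K ≤ R := by
    refine le_radical inferInstance ?_
    rw [fittingProd_iff_map_mk hE _ (hF.radical_of_normal _ inferInstance), piGroups,
      isPiGroup_iff_pow]
    rintro ⟨_, x, hx, rfl⟩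
    obtain ⟨n, hn, hnσ, h1⟩ := isPiGroup_iff_pow.1 (hE.radical_mem (G ⧸ R)) ⟨_, hx⟩
    have h2 : x ^ n ∈ R := by
      rw [← QuotientGroup.eq_one_iff]
      exact congrArg Subtype.val h1
    rw [hR, radical_fittingProd hF hE] at h2
    obtain ⟨m, hm, hmσ, h3⟩ := isPiGroup_iff_pow.1 (hE.radical_mem (G ⧸ radical F G)) ⟨_, h2⟩
    refine ⟨n * m, mul_ne_zero hn hm, fun p hp hd => ?_, Subtype.ext ?_⟩
    · rcases hp.dvd_mul.1 hd with h | h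
      exacts [hnσ p hp h, hmσ p hp h]
    · have h4 : (QuotientGroup.mk' (radical F G) (x ^ n)) ^ m = 1 := congrArg Subtype.val h3
      rw [map_pow, ← pow_mul] at h4
      exact h4
  rw [← map_comap_mk (radical (piGroups σ) (G ⧸ R)), ← hK, eq_bot_iff,
    Subgroup.map_le_iff_le_comap, MonoidHom.comap_bot, QuotientGroup.ker_mk']
  exact hKR

end FittingProduct

/-! ### π-nilpotent groups as π'-by-(nilpotent π) -/

section PiNilpotent

variable {G : Type u} [Group G] [Finite G] {π : Set ℕ}

theorem nilPi.isPNilpotent (h : nilPi π G) (p : ℕ) : IsPNilpotent p G := by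
  refine ⟨radical (piGroups {p}ᶜ) G, radical_normal _ G,
    (isFitting_piGroups {p}ᶜ).radical_mem G, fun q hq hd hqp => ?_⟩
  have := Fact.mk hq
  let S : Sylow q G := default
  refine S.not_dvd_index (hd.trans (Subgroup.index_dvd_of_le fun x hx => ?_))
  exact nilPi.mem_radical Subgroup.normal_top
    (h.of_injective (⊤ : Subgroup G).subtype (Subgroup.subtype_injective _)) hq hqp
    (Subgroup.mem_top x) (isPElement_of_mem S.2 hx)

theorem IsPNilpotent.of_quotient {p : ℕ} {S : Subgroup G} [S.Normal]
    (hS : IsPiGroup {p}ᶜ S) (h : IsPNilpotent p (G ⧸ S)) : IsPNilpotent p G := by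
  obtain ⟨N, hN, hNp, hidx⟩ := h
  refine ⟨N.comap (QuotientGroup.mk' S), hN.comap _, ?_, ?_⟩
  · rw [isPiGroup_iff_pow]
    rintro ⟨x, hx⟩
    obtain ⟨n, hn, hnσ, h1⟩ := isPiGroup_iff_pow.1 hNp ⟨_, hx⟩
    have h2 : x ^ n ∈ S := by
      rw [← QuotientGroup.eq_one_iff]
      exact congrArg Subtype.val h1
    obtain ⟨m, hm, hmσ, h3⟩ := isPiGroup_iff_pow.1 hS ⟨_, h2⟩
    refine ⟨n * m, mul_ne_zero hn hm, fun q hq hd => ?_, Subtype.ext ?_⟩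
    · rcases hq.dvd_mul.1 hd with h | h
      exacts [hnσ q hq h, hmσ q hq h]
    · have h4 : (x ^ n) ^ m = 1 := congrArg Subtype.val h3
      rw [← pow_mul] at h4
      exact h4
  · rw [Subgroup.index_comap_of_surjective _ (QuotientGroup.mk'_surjective S)]
    exact hidx

/-- The intersection of the normal Hall `p'`-subgroups `N p`, `p ∈ π`, is a normal `π'`-group. For
distinct primes `q`, `r`, each `N p` contains every `q`-element or every `r`-element, so their
commutators vanish modulo the `π'`-radical. -/
theorem piNilpotent_iff :
    PiNilpotent π G ↔ fittingProd (piGroups πᶜ) (nilPi π) G := by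
  have hO := (isFitting_piGroups πᶜ).radical_mem G
  constructor
  · intro h
    choose N hNn hNp hNi using h
    have hinf : ∀ x : G, (∀ p (hp : p ∈ π), x ∈ N p hp) → x ∈ radical (piGroups πᶜ) G := by
      intro x hx
      let I : Subgroup G := ⨅ p : π, N p.1 p.2
      have hI : I.Normal := Subgroup.normal_iInf_normal fun p => hNn p.1 p.2
      refine le_radical hI ?_ (Subgroup.mem_iInf.2 fun p => hx p.1 p.2)
      intro q hq hd hqπ
      exact hNp q hqπ q hq (hd.trans (Subgroup.card_dvd_of_le (iInf_le _ (⟨q, hqπ⟩ : π)))) rfl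
    have hmem : ∀ p (hp : p ∈ π) (q : ℕ), q.Prime → q ≠ p → ∀ x : G,
        IsPElement q (x : G ⧸ radical (piGroups πᶜ) G) → x ∈ N p hp := by
      intro p hp q hq hqp x hx
      have hnorm := hNn p hp
      have hle : radical (piGroups πᶜ) G ≤ N p hp := by
        refine le_of_isPElement fun r hr y hy hyr => ?_
        by_cases hy1 : y = 1
        · exact hy1 ▸ one_mem _
        have hrπ : r ∈ πᶜ := by
          by_contra hrπ
          exact hy1 (congrArg Subtype.val (IsPElement.eq_one_of_isPiGroup hr hrπ hO
            (x := (⟨y, hy⟩ : radical (piGroups πᶜ) G)) hyr.of_coe))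
        have hyq : IsPElement r (y : G ⧸ N p hp) := hyr.map (QuotientGroup.mk' (N p hp))
        rw [← QuotientGroup.eq_one_iff]
        refine hyq.eq_one_of_isPiGroup hr (σ := {p}) (fun h => hrπ ?_)
          (fun s hs hd => not_not.1 (hNi p hp s hs hd))
        rw [Set.mem_singleton_iff.1 h]
        exact hp
      rw [← QuotientGroup.eq_one_iff]
      have hxq : IsPElement q (x : G ⧸ N p hp) := by
        obtain ⟨k, hk⟩ := hx
        refine ⟨k, ?_⟩
        rw [← QuotientGroup.mk_pow, QuotientGroup.eq_one_iff] at hk ⊢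
        exact hle hk
      exact hxq.eq_one_of_isPiGroup hq (σ := {p}) hqp
        (fun s hs hd => not_not.1 (hNi p hp s hs hd))
    refine ⟨isPiGroup_iff_isPElement.2 fun q hq hqπ x hx => ?_, fun q r hq hr hqr x y hx hy => ?_⟩
    · obtain ⟨x, rfl⟩ := QuotientGroup.mk_surjective x
      rw [QuotientGroup.eq_one_iff]
      exact hinf x fun p hp => hmem p hp q hq (fun h => hqπ (h ▸ hp)) x hx
    · obtain ⟨x, rfl⟩ := QuotientGroup.mk_surjective x
      obtain ⟨y, rfl⟩ := QuotientGroup.mk_surjective y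
      have hcomm : x * y * x⁻¹ * y⁻¹ ∈ radical (piGroups πᶜ) G := by
        refine hinf _ fun p hp => ?_
        rcases eq_or_ne q p with rfl | hqp
        · have hy' := hmem q hp r hr hqr.symm y hy
          exact mul_mem ((hNn q hp).conj_mem y hy' x) (inv_mem hy')
        · have hx' := hmem p hp q hq hqp x hx
          have := mul_mem hx' ((hNn p hp).conj_mem _ (inv_mem hx') y)
          simpa [mul_assoc] using this
      rw [← QuotientGroup.eq_one_iff] at hcomm
      simp only [QuotientGroup.mk_mul, QuotientGroup.mk_inv] at hcomm
      rw [mul_inv_eq_one, mul_inv_eq_iff_eq_mul] at hcomm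
      exact hcomm
  · intro h p hp
    exact IsPNilpotent.of_quotient
      (fun q hq hd hqp => hO q hq hd ((hqp : q = p) ▸ hp)) (nilPi.isPNilpotent h p)

end PiNilpotent

end PiSol

namespace PiSol

/-! ### Lifting from the quotient, and injectors -/

section Transfer

variable {F L : GroupClass.{u}} {G Q : Type u} [Group G] [Group Q] [Finite G] {π : Set ℕ}

/-- A subgroup above the `FL`-radical has the same `F`-radical as the group. -/
theorem radical_eq_of_radical_le (hF : IsFitting F) (hL : IsFitting L)
    (hC : Subgroup.centralizer (radical L (G ⧸ radical F G) : Set (G ⧸ radical F G)) ≤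
      radical L (G ⧸ radical F G))
    {V : Subgroup G} (hV : radical (fittingProd F L) G ≤ V) :
    radical F V = (radical F G).subgroupOf V := by
  have hRT := radical_le_radical_fittingProd (G := G) hF hL
  have hRV := hRT.trans hV
  refine le_antisymm ?_ (le_radical inferInstance
    (hF.iso (Subgroup.subgroupOfEquivOfLe hRV).symm (hF.radical_mem G)))
  set X := (radical F V).map V.subtype with hX
  have hXV : X ≤ V := Subgroup.map_subtype_le _
  have hXn : ∀ x ∈ X, ∀ v ∈ V, v * x * v⁻¹ ∈ X := by
    rintro _ ⟨x, hx, rfl⟩ v hv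
    exact ⟨_, (radical_normal F V).conj_mem x hx ⟨v, hv⟩, rfl⟩
  have hXF : F X :=
    hF.iso ((radical F V).equivMapOfInjective _ V.subtype_injective) (hF.radical_mem V)
  -- This intersection is a subnormal `F`-subgroup of `G`. It contains the commutators of `X` with
  -- the `FL`-radical, so modulo `radical F G` the subgroup `X` centralizes the `L`-radical, and
  -- `hC` puts `X` in the `FL`-radical.
  have hXT : X ⊓ radical (fittingProd F L) G ≤ radical F G := by
    refine hF.le_radical_of_subnormal ?_ (hF.of_normal_le inf_le_left ?_ hXF)
    · refine Subgroup.IsSubnormal.step _ _ inf_le_right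
        (radical_normal (fittingProd F L) G).isSubnormal ⟨fun n hn g => ?_⟩
      exact ⟨hXn _ hn.1 _ (hV g.2), (radical_normal (fittingProd F L) G).conj_mem _ hn.2 _⟩
    · rw [Subgroup.inf_subgroupOf_left]
      infer_instance
  refine Subgroup.map_le_iff_le_comap.1 fun x hx => hXT ⟨hx, ?_⟩
  rw [radical_fittingProd hF hL]
  refine hC (Subgroup.mem_centralizer_iff.2 fun t ht => ?_)
  obtain ⟨t, rfl⟩ := QuotientGroup.mk_surjective t
  have htT : t ∈ radical (fittingProd F L) G := by
    rw [radical_fittingProd hF hL]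
    exact ht
  have hcomm : t * x * t⁻¹ * x⁻¹ ∈ radical F G := by
    refine hXT ⟨mul_mem (hXn x hx t (hV htT)) (X.inv_mem hx), ?_⟩
    rw [mul_assoc, mul_assoc, ← mul_assoc x]
    exact mul_mem htT ((radical_normal (fittingProd F L) G).conj_mem _
      ((radical (fittingProd F L) G).inv_mem htT) x)
  rw [← QuotientGroup.eq_one_iff] at hcomm
  simp only [QuotientGroup.mk_mul, QuotientGroup.mk_inv] at hcomm
  rw [mul_inv_eq_one, mul_inv_eq_iff_eq_mul] at hcomm
  exact hcomm

theorem IsRadMaximal.map_mk (hF : IsFitting F) (hL : IsFitting L)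
    (hC : Subgroup.centralizer (radical L (G ⧸ radical F G) : Set (G ⧸ radical F G)) ≤
      radical L (G ⧸ radical F G))
    {V : Subgroup G} (hV : IsRadMaximal (fittingProd F L) V) :
    IsRadMaximal L (V.map (QuotientGroup.mk' (radical F G))) where
  radical_le := by
    have h := Subgroup.map_mono (f := QuotientGroup.mk' (radical F G)) hV.radical_le
    rwa [radical_fittingProd hF hL, map_comap_mk] at h
  mem := (fittingProd_iff_map_mk hL V (radical_eq_of_radical_le hF hL hC hV.radical_le)).1 hV.mem
  le_of_le U hU h := by
    have hVU := Subgroup.map_le_iff_le_comap.1 hU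
    have h1 := hV.le_of_le _ hVU ((fittingProd_iff_map_mk hL _
      (radical_eq_of_radical_le hF hL hC (hV.radical_le.trans hVU))).2 (by rwa [map_comap_mk]))
    rw [← map_comap_mk U]
    exact Subgroup.map_mono h1

theorem ker_mk_le_of_isRadMaximal (hF : IsFitting F) (hL : IsFitting L) {V : Subgroup G}
    (hV : IsRadMaximal (fittingProd F L) V) : (QuotientGroup.mk' (radical F G)).ker ≤ V := by
  rw [QuotientGroup.ker_mk']
  exact (radical_le_radical_fittingProd hF hL).trans hV.radical_le

theorem HasPiSeries.centralizer_radical_quotient_le (hG : HasPiSeries π G) (hF : IsFitting F) :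
    Subgroup.centralizer (radical (nilPi π) (G ⧸ radical (fittingProd F (piGroups πᶜ)) G) :
      Set (G ⧸ radical (fittingProd F (piGroups πᶜ)) G)) ≤
      radical (nilPi π) (G ⧸ radical (fittingProd F (piGroups πᶜ)) G) :=
  (hG.of_surjective _ (QuotientGroup.mk'_surjective _)).centralizer_radical_le
    (radical_piGroups_quotient hF πᶜ)

theorem IsRadMaximal.exists_conj_eq (hF : IsFitting F) (hG : HasPiSeries π G) {V W : Subgroup G}
    (hV : IsRadMaximal (fittingProd (fittingProd F (piGroups πᶜ)) (nilPi π)) V)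
    (hW : IsRadMaximal (fittingProd (fittingProd F (piGroups πᶜ)) (nilPi π)) W) :
    ∃ g : G, V.map (MulAut.conj g).toMonoidHom = W := by
  have hC := hG.centralizer_radical_quotient_le hF
  have hF' := hF.fittingProd (isFitting_piGroups πᶜ)
  have hL := isFitting_nilPi.{u} π
  obtain ⟨a, ha⟩ := (hV.map_mk hF' hL hC).conj_nilPi hC (hW.map_mk hF' hL hC)
  obtain ⟨g, rfl⟩ := QuotientGroup.mk_surjective a
  have hle : V.map (MulAut.conj g).toMonoidHom ≤ W := by
    rintro _ ⟨v, hv, rfl⟩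
    refine mem_of_map_mem (ker_mk_le_of_isRadMaximal hF' hL hW) ?_
    rw [← ha]
    exact ⟨_, ⟨v, hv, rfl⟩, rfl⟩
  exact ⟨g, le_antisymm hle
    ((hV.map (hF'.fittingProd hL) (MulAut.conj g)).le_of_le W hle hW.mem)⟩

/-- A competitor `U` in `K` has the radical of `G` intersected with `U` as its own, so its image in
the quotient of `G` is a nilpotent π-group, and `IsRadMaximal.le_of_inf_le` applies there. -/
theorem IsRadMaximal.subgroupOf (hF : IsFitting F) (hG : HasPiSeries π G) {V : Subgroup G}
    (hV : IsRadMaximal (fittingProd (fittingProd F (piGroups πᶜ)) (nilPi π)) V) {K : Subgroup G}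
    (hK : K.Normal) :
    IsRadMaximal (fittingProd (fittingProd F (piGroups πᶜ)) (nilPi π)) (V.subgroupOf K) := by
  have hF' := hF.fittingProd (isFitting_piGroups πᶜ)
  have hL := isFitting_nilPi.{u} π
  have hP := hF'.fittingProd hL
  have hT := hP.radical_of_normal K hK
  have hTV : radical (fittingProd (fittingProd F (piGroups πᶜ)) (nilPi π)) K ≤ V.subgroupOf K := by
    rw [hT]
    exact Subgroup.comap_mono hV.radical_le
  refine ⟨hTV, ?_, fun U hVU hU u hu => ?_⟩
  · have h1 : fittingProd (fittingProd F (piGroups πᶜ)) (nilPi π) (V ⊓ K : Subgroup G) :=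
      hP.of_normal_le inf_le_left (by rw [Subgroup.inf_subgroupOf_left]; infer_instance) hV.mem
    rw [← Subgroup.inf_subgroupOf_right]
    exact hP.iso (Subgroup.subgroupOfEquivOfLe inf_le_right).symm h1
  · have hC := hG.centralizer_radical_quotient_le hF
    have hCK := (hG.subgroup K).centralizer_radical_quotient_le hF
    let f := (QuotientGroup.mk' (radical (fittingProd F (piGroups πᶜ)) G)).comp K.subtype
    have hker : radical (fittingProd F (piGroups πᶜ)) U = f.ker.subgroupOf U := by
      rw [radical_eq_of_radical_le hF' hL hCK (hTV.trans hVU), hF'.radical_of_normal K hK,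
        ← MonoidHom.comap_ker, QuotientGroup.ker_mk']
      rfl
    have hUL : nilPi π (U.map f) := (fittingProd_iff_map hL f U hker).1 hU
    have hRV := ker_mk_le_of_isRadMaximal hF' hL hV
    have hle := (hV.map_mk hF' hL hC).le_of_inf_le hC
      (hK.map _ (QuotientGroup.mk'_surjective (radical (fittingProd F (piGroups πᶜ)) G)))
      (U := U.map f) (by rintro _ ⟨x, -, rfl⟩; exact ⟨x, x.2, rfl⟩) hUL (by
        rintro y ⟨hyV, k, hk, rfl⟩
        have hkV : k ∈ V := mem_of_map_mem hRV hyV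
        exact ⟨⟨k, hk⟩, hVU hkV, rfl⟩)
    exact mem_of_map_mem hRV (hle ⟨u, hu, rfl⟩)

theorem IsRadMaximal.subgroupOf_subnormal (hF : IsFitting F) (hG : HasPiSeries π G)
    {V : Subgroup G}
    (hV : IsRadMaximal (fittingProd (fittingProd F (piGroups πᶜ)) (nilPi π)) V) {K : Subgroup G}
    (hK : K.IsSubnormal) :
    IsRadMaximal (fittingProd (fittingProd F (piGroups πᶜ)) (nilPi π)) (V.subgroupOf K) := by
  have hP := (hF.fittingProd (isFitting_piGroups πᶜ)).fittingProd (isFitting_nilPi.{u} π)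
  induction hK with
  | top => exact hV.subgroupOf hF hG Subgroup.normal_top
  | step A B hAB hB hN ih =>
    have h := (ih.subgroupOf hF (hG.subgroup B) hN).map hP (Subgroup.subgroupOfEquivOfLe hAB)
    convert h using 1
    ext x
    simp only [Subgroup.mem_map, Subgroup.mem_subgroupOf]
    constructor
    · exact fun hx => ⟨⟨⟨x, hAB x.2⟩, x.2⟩, hx, rfl⟩
    · rintro ⟨y, hy, rfl⟩
      exact hy

theorem isMaximalIn_of_subgroupOf (hF : IsFitting F) {V K : Subgroup G}
    (h : IsRadMaximal F (V.subgroupOf K)) : IsMaximalIn F (V ⊓ K) K := by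
  refine ⟨inf_le_right, ?_, fun U hVU hUK hU => le_antisymm (fun u hu => ⟨?_, hUK hu⟩) hVU⟩
  · have h1 := h.mem
    rw [← Subgroup.inf_subgroupOf_right] at h1
    exact hF.iso (Subgroup.subgroupOfEquivOfLe inf_le_right) h1
  · exact h.le_of_le (U.subgroupOf K) (fun x hx => hVU ⟨hx, x.2⟩)
      (hF.iso (Subgroup.subgroupOfEquivOfLe hUK).symm hU) (x := ⟨u, hUK hu⟩) hu

/-- Only two subnormal subgroups need testing: `G` itself for maximality, and the radical for
containment. -/
theorem IsInjector.isRadMaximal (hF : IsFitting F) {V : Subgroup G} (h : IsInjector F V) :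
    IsRadMaximal F V := by
  have h1 := h ⊤ Subgroup.IsSubnormal.top
  rw [inf_top_eq] at h1
  refine ⟨?_, h1.2.1, fun U hU hUF => (h1.2.2 U hU le_top hUF).le⟩
  have h2 := (h _ (radical_normal F G).isSubnormal).2.2 _ inf_le_right le_rfl (hF.radical_mem G)
  exact h2.le.trans inf_le_left

theorem isInjector_iff_isRadMaximal (hF : IsFitting F) (hG : HasPiSeries π G) {V : Subgroup G} :
    IsInjector (fittingProd (fittingProd F (piGroups πᶜ)) (nilPi π)) V ↔
      IsRadMaximal (fittingProd (fittingProd F (piGroups πᶜ)) (nilPi π)) V := by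
  have hP := (hF.fittingProd (isFitting_piGroups πᶜ)).fittingProd (isFitting_nilPi.{u} π)
  exact ⟨fun h => h.isRadMaximal hP,
    fun h K hK => isMaximalIn_of_subgroupOf hP (h.subgroupOf_subnormal hF hG hK)⟩

theorem IsInjector.congr {F' : GroupClass.{u}}
    (h : ∀ (K : Type u) [Group K] [Finite K], F K ↔ F' K) {V : Subgroup G} :
    IsInjector F V ↔ IsInjector F' V := by
  have key : ∀ U : Subgroup G, F U ↔ F' U := fun U => h U
  simp only [IsInjector, IsMaximalIn, key]

end Transfer

theorem subgroup_subsingleton_iff {G : Type u} [Group G] {K : Subgroup G} :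
    Subsingleton K ↔ K = ⊥ := by
  rw [← not_nontrivial_iff_subsingleton, Subgroup.nontrivial_iff_ne_bot, not_not]

theorem isFitting_trivialClass : IsFitting trivialClass.{u} where
  of_subsingleton _ _ h := h
  iso e (hG : Subsingleton _) := e.symm.toEquiv.subsingleton
  normal N _ (hG : Subsingleton _) := inferInstanceAs (Subsingleton N)
  sup {G} _ _ N M _ _ (h1 : Subsingleton N) (h2 : Subsingleton M) h3 := by
    rw [subgroup_subsingleton_iff] at h1 h2
    rw [h1, h2, sup_bot_eq] at h3
    exact Subgroup.subsingleton_iff.1 (subsingleton_of_bot_eq_top h3)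

theorem fittingProd_piNilpotent_iff {F : GroupClass.{u}} (hF : IsFitting F) (π : Set ℕ)
    (G : Type u) [Group G] [Finite G] : fittingProd F (PiNilpotent π) G ↔
      fittingProd (fittingProd F (piGroups πᶜ)) (nilPi π) G := by
  rw [fittingProd_assoc hF (isFitting_piGroups πᶜ) (isFitting_nilPi π)]
  exact piNilpotent_iff

theorem isFitting_fittingPow (π : Set ℕ) (k : ℕ) :
    IsFitting (fittingPow (PiNilpotent.{u} π) k) := by
  induction k with
  | zero => exact isFitting_trivialClass
  | succ k ih =>
    exact ((ih.fittingProd (isFitting_piGroups πᶜ)).fittingProd (isFitting_nilPi π)).congr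
      fun G _ _ => fittingProd_piNilpotent_iff ih π G

theorem isInjector_trivialClass_iff {G : Type u} [Group G] {V : Subgroup G} :
    IsInjector trivialClass V ↔ V = ⊥ := by
  constructor
  · intro h
    have h1 := (h ⊤ Subgroup.IsSubnormal.top).2.1
    rw [inf_top_eq] at h1
    exact subgroup_subsingleton_iff.1 h1
  · rintro rfl K -
    rw [bot_inf_eq]
    exact ⟨bot_le, subgroup_subsingleton_iff.2 rfl,
      fun U _ _ hU => subgroup_subsingleton_iff.1 hU⟩

end PiSol

/-- Every finite `π`-soluble group has an `(𝔑^π)^k`-injector, and any two are conjugate. -/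
theorem corollary1p5p2 (π : Set ℕ) (hπ : ∀ p ∈ π, p.Prime) (k : ℕ)
    (G : Type u) [Group G] [Finite G] (hG : PiSol.IsPiSoluble π G) :
    (∃ V : Subgroup G, PiSol.IsInjector (PiSol.fittingPow (PiSol.PiNilpotent π) k) V) ∧
      ∀ V W : Subgroup G,
        PiSol.IsInjector (PiSol.fittingPow (PiSol.PiNilpotent π) k) V →
        PiSol.IsInjector (PiSol.fittingPow (PiSol.PiNilpotent π) k) W →
        ∃ g : G, V.map (MulAut.conj g).toMonoidHom = W := by
  cases k with
  | zero =>
    -- The trivial class is not presented as a product ending in nilpotent π-groups; its only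
    -- injector is the trivial subgroup.
    simp only [PiSol.fittingPow, PiSol.isInjector_trivialClass_iff]
    exact ⟨⟨⊥, rfl⟩, fun V W hV hW => ⟨1, by rw [hV, hW, Subgroup.map_bot]⟩⟩
  | succ k =>
    have hF := PiSol.isFitting_fittingPow.{u} π k
    have hP := (hF.fittingProd (PiSol.isFitting_piGroups πᶜ)).fittingProd (PiSol.isFitting_nilPi π)
    have hiff : ∀ V : Subgroup G,
        PiSol.IsInjector (PiSol.fittingPow (PiSol.PiNilpotent π) (k + 1)) V ↔
          PiSol.IsRadMaximal _ V := fun V =>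
      (PiSol.IsInjector.congr fun K _ _ => PiSol.fittingProd_piNilpotent_iff hF π K).trans
        (PiSol.isInjector_iff_isRadMaximal hF (hG.hasPiSeries hπ))
    simp only [hiff]
    exact ⟨hP.exists_isRadMaximal G, fun V W hV hW =>
      hV.exists_conj_eq hF (hG.hasPiSeries hπ) hW⟩
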